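/- **Theorem.** Let $\sigma_0$ be a measurable function on $(0,\infty)$ such that, almost everywhere, $\sigma_0\ge 0$, $\sigma_0$ is essentially bounded on every compact subset of $(0,\infty)$, $\sigma_0(\lambda)=O(\lambda^{-l_+})$ as $\lambda\to 0$ for some $l_+<1$, and $\sigma_0(\lambda)=O(\lambda^{l_-})$ as $\lambda\to\infty$ for some $l_-\in\mathbb R$. Let $(\mathsf Lf)(\lambda)=\int_0^\infty e^{-t\lambda}f(t)\,dt$ and let $H_0$ be the operator in $L^2(0,\infty)$ associated with the quadratic form $$h_0[f,f]=\int_0^\infty|(\mathsf Lf)(\lambda)|^2\sigma_0(\lambda)\,d\lambda$$ on the domain $\mathcal D[h_0]$ of all $f\in L^2(0,\infty)$ for which this integral is finite. Let $M\ge 0$, let $\beta_1,\dots,\beta_M$ be pairwise distinct complex numbers with $\operatorname{Re}\beta_m>0$, let $P_1,\dots,P_M$ be nonzero complex polynomials, put $K_m=\deg P_m$, and suppose that the kernel $$v(t)=\sum_{m=1}^M P_m(t)e^{-\beta_m t}$$ satisfies $v(t)=\overline{v(t)}$ for all $t>0$. Let $V$ be the finite-rank self-adjoint Hankel operator $(Vf)(t)=\int_0^\infty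 v(t+s)f(s)\,ds$ in $L^2(0,\infty)$, and let $H$ be the operator associated with the form $h[f,f]=h_0[f,f]+(Vf,f)$ on $\mathcal D[h_0]$. (If $\operatorname{Im}\beta_m=0$ then $P_m$ has real coefficients, and if $\operatorname{Im}\beta_m\ne0$ then $\overline{\beta_m}$ is also among the exponents, with polynomial $\overline{P_m}$.) For $\operatorname{Im}\beta_m=0$ set $$\mathcal N_m=\begin{cases}(K_m+1)/2,&K_m\text{ odd},\\ K_m/2,&K_m\text{ even and the leading coefficient of }P_m\text{ is positive},\\ K_m/2+1,&K_m\text{ even and the leading coefficient of }P_m\text{ is negative.}\end{cases}$$ Then $H_0$ and $H$ are self-adjoint, $V$ is defined on all of $L^2(0,\infty)$, $H=H_0+V$, and the total number $N_-(H)$ of strictly negative eigenvalues of $H$, counted with multiplicity, which is also the maximal dimension of linear sets $\mathcal K\subset\mathcal D[h_0]$ with $h[f,f]<0$ for all nonzero $f\in\mathcal K$, is $$N_-(H)=\sum_{m:\ \operatorname{Im}\beta_m=0}\mathcal N_m+\sum_{m:\ \operatorname{Im}\beta_m>0}(K_m+1).$$ In particular this number does not depend on $H_0$. -/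

import Mathlib

open MeasureTheory Filter Topology Polynomial
open scoped ENNReal ComplexConjugate

noncomputable section

namespace Hankel

/-- Lebesgue measure on the half-line `(0, ∞)`. -/
abbrev halfLine : Measure ℝ := volume.restrict (Set.Ioi 0)

/-- The Hilbert space of square integrable complex functions on the half-line. -/
abbrev L2 : Type := Lp ℂ 2 halfLine

/-- The measure `σ₀(x) dx` on `(0, ∞)`. Only the values of `σ₀` on `(0, ∞)` matter. -/
def sigmaMeasure (σ₀ : ℝ → ℝ) : Measure ℝ :=
  halfLine.withDensity fun x => ENNReal.ofReal (σ₀ x)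

/-- The standing assumption on the sigma-function of the unperturbed operator: it is a nonnegative
measurable function on `(0, ∞)`, essentially bounded on compact subsets of `(0, ∞)`, and it is
`O(x ^ (-l₊))` at `0` for some `l₊ < 1` and `O(x ^ l₋)` at infinity for some real `l₋`
(all relations being understood almost everywhere). -/
structure IsAdmissibleSigma (σ₀ : ℝ → ℝ) : Prop where
  aemeasurable : AEMeasurable σ₀ halfLine
  nonneg : ∀ᵐ x ∂halfLine, 0 ≤ σ₀ x
  locally_bounded : ∀ a b : ℝ, 0 < a → ∃ C : ℝ, ∀ᵐ x ∂halfLine, x ∈ Set.Icc a b → |σ₀ x| ≤ C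
  isBigO_zero : ∃ lp : ℝ, lp < 1 ∧ σ₀ =O[𝓝[>] 0 ⊓ ae volume] fun x : ℝ => x ^ (-lp)
  isBigO_infty : ∃ lm : ℝ, σ₀ =O[atTop ⊓ ae volume] fun x : ℝ => x ^ lm

/-- The Laplace transform `(𝖫 f)(x) = ∫₀^∞ e^{-t x} f(t) dt`. -/
def laplace (f : L2) (x : ℝ) : ℂ :=
  ∫ t, (Real.exp (-(t * x)) : ℂ) * f t ∂halfLine

theorem integrable_laplace (f : L2) {x : ℝ} (hx : 0 < x) :
    Integrable (fun t => (Real.exp (-(t * x)) : ℂ) * f t) halfLine := by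
  have h1 : MemLp (fun t : ℝ => (Real.exp (-(t * x)) : ℂ)) 2 halfLine := by
    rw [memLp_two_iff_integrable_sq_norm (by fun_prop)]
    have h2 : IntegrableOn (fun t : ℝ => Real.exp (-(2 * x) * t)) (Set.Ioi 0) :=
      exp_neg_integrableOn_Ioi 0 (by positivity)
    refine h2.congr (ae_of_all _ fun t => ?_)
    simp only [Complex.norm_real, Real.norm_eq_abs, Real.abs_exp, ← Real.exp_nat_mul]
    congr 1
    push_cast
    ring
  exact h1.integrable_mul (Lp.memLp f)

theorem ae_pos_sigmaMeasure (σ₀ : ℝ → ℝ) : ∀ᵐ x ∂sigmaMeasure σ₀, 0 < x :=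
  (withDensity_absolutelyContinuous _ _).ae_le (ae_restrict_mem measurableSet_Ioi)

theorem laplace_add (σ₀ : ℝ → ℝ) (f g : L2) :
    laplace (f + g) =ᵐ[sigmaMeasure σ₀] laplace f + laplace g := by
  filter_upwards [ae_pos_sigmaMeasure σ₀] with x hx
  simp only [laplace, Pi.add_apply]
  rw [← integral_add (integrable_laplace f hx) (integrable_laplace g hx)]
  refine integral_congr_ae ?_
  filter_upwards [Lp.coeFn_add f g] with t ht
  rw [ht, Pi.add_apply, mul_add]

theorem laplace_smul (σ₀ : ℝ → ℝ) (c : ℂ) (f : L2) :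
    laplace (c • f) =ᵐ[sigmaMeasure σ₀] c • laplace f := by
  refine ae_of_all _ fun x => ?_
  simp only [laplace, Pi.smul_apply, smul_eq_mul]
  rw [← integral_const_mul]
  refine integral_congr_ae ?_
  filter_upwards [Lp.coeFn_smul c f] with t ht
  rw [ht, Pi.smul_apply, smul_eq_mul]
  ring

theorem laplace_zero (σ₀ : ℝ → ℝ) : laplace 0 =ᵐ[sigmaMeasure σ₀] (0 : ℝ → ℂ) := by
  simpa using laplace_smul σ₀ 0 0

/-- The set of all `f ∈ L²(0, ∞)` with `∫₀^∞ |(𝖫 f)(x)|² σ₀(x) dx < ∞`. -/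
def laplaceDomain (σ₀ : ℝ → ℝ) : Submodule ℂ L2 where
  carrier := {f | MemLp (laplace f) 2 (sigmaMeasure σ₀)}
  add_mem' := fun {f g} hf hg => (memLp_congr_ae (laplace_add σ₀ f g)).2 (MemLp.add hf hg)
  zero_mem' := (memLp_congr_ae (laplace_zero σ₀)).2 MemLp.zero
  smul_mem' := fun c f hf => (memLp_congr_ae (laplace_smul σ₀ c f)).2 (MemLp.const_smul hf c)

/-- The Laplace transform as an operator from `L²(0, ∞)` to `L²(σ₀(x) dx)`, on its maximal
domain. -/
def laplaceOperator (σ₀ : ℝ → ℝ) : L2 →ₗ.[ℂ] Lp ℂ 2 (sigmaMeasure σ₀) where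
  domain := laplaceDomain σ₀
  toFun :=
    { toFun := fun f => MemLp.toLp (laplace f) f.2
      map_add' := fun f g => (MemLp.toLp_congr _ _ (laplace_add σ₀ f g)).trans
        (MemLp.toLp_add f.2 g.2)
      map_smul' := fun c f => (MemLp.toLp_congr _ _ (laplace_smul σ₀ c f)).trans
        (MemLp.toLp_const_smul c f.2) }

/-- The function `t ↦ ∫₀^∞ v(t + s) f(s) ds`. -/
def hankelIntegral (v : ℝ → ℂ) (f : L2) (t : ℝ) : ℂ :=
  ∫ s, v (t + s) * f s ∂halfLine

theorem hankel_add_ae (v : ℝ → ℂ) (f g : L2) (t : ℝ) :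
    (fun s => v (t + s) * (f + g : L2) s) =ᵐ[halfLine]
      fun s => v (t + s) * f s + v (t + s) * g s := by
  filter_upwards [Lp.coeFn_add f g] with s hs
  rw [hs, Pi.add_apply, mul_add]

theorem hankel_smul_ae (v : ℝ → ℂ) (c : ℂ) (f : L2) (t : ℝ) :
    (fun s => v (t + s) * (c • f : L2) s) =ᵐ[halfLine] fun s => c * (v (t + s) * f s) := by
  filter_upwards [Lp.coeFn_smul c f] with s hs
  rw [hs, Pi.smul_apply, smul_eq_mul]
  ring

theorem hankelIntegral_add (v : ℝ → ℂ) (f g : L2)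
    (hf : ∀ᵐ t ∂halfLine, Integrable (fun s => v (t + s) * f s) halfLine)
    (hg : ∀ᵐ t ∂halfLine, Integrable (fun s => v (t + s) * g s) halfLine) :
    hankelIntegral v (f + g) =ᵐ[halfLine] hankelIntegral v f + hankelIntegral v g := by
  filter_upwards [hf, hg] with t h1 h2
  rw [hankelIntegral, integral_congr_ae (hankel_add_ae v f g t), integral_add h1 h2]
  rfl

theorem hankelIntegral_smul (v : ℝ → ℂ) (c : ℂ) (f : L2) :
    hankelIntegral v (c • f) = c • hankelIntegral v f := by
  funext t
  rw [hankelIntegral, integral_congr_ae (hankel_smul_ae v c f t), integral_const_mul]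
  rfl

/-- The set of all `f ∈ L²(0, ∞)` for which `∫₀^∞ v(t + s) f(s) ds` converges absolutely for almost
every `t > 0` and defines a square integrable function of `t`. -/
def hankelDomain (v : ℝ → ℂ) : Submodule ℂ L2 where
  carrier := {f | (∀ᵐ t ∂halfLine, Integrable (fun s => v (t + s) * f s) halfLine) ∧
    MemLp (hankelIntegral v f) 2 halfLine}
  add_mem' := by
    rintro f g ⟨hf, hf'⟩ ⟨hg, hg'⟩
    refine ⟨?_, (memLp_congr_ae (hankelIntegral_add v f g hf hg)).2 (hf'.add hg')⟩
    filter_upwards [hf, hg] with t h1 h2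
    exact (h1.add h2).congr (hankel_add_ae v f g t).symm
  zero_mem' := by
    have h : hankelIntegral v 0 = 0 := by simpa using hankelIntegral_smul v 0 0
    refine ⟨ae_of_all _ fun t => ?_, by rw [h]; exact MemLp.zero⟩
    refine (integrable_zero ℝ ℂ halfLine).congr ?_
    filter_upwards [Lp.coeFn_zero ℂ 2 halfLine] with s hs
    rw [hs, Pi.zero_apply, mul_zero]
  smul_mem' := by
    rintro c f ⟨hf, hf'⟩
    refine ⟨?_, by rw [hankelIntegral_smul]; exact hf'.const_smul c⟩
    filter_upwards [hf] with t h1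
    exact (h1.const_mul c).congr (hankel_smul_ae v c f t).symm

/-- The Hankel operator `(V f)(t) = ∫₀^∞ v(t + s) f(s) ds` in `L²(0, ∞)` on its maximal domain. -/
def hankelOperator (v : ℝ → ℂ) : L2 →ₗ.[ℂ] L2 where
  domain := hankelDomain v
  toFun :=
    { toFun := fun f => MemLp.toLp (hankelIntegral v f) f.2.2
      map_add' := fun f g =>
        (MemLp.toLp_congr _ _ (hankelIntegral_add v f g f.2.1 g.2.1)).trans
          (MemLp.toLp_add f.2.2 g.2.2)
      map_smul' := fun c f =>
        (MemLp.toLp_congr _ (MemLp.const_smul f.2.2 c)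
          (ae_of_all _ (congrFun (hankelIntegral_smul v c f)))).trans
          (MemLp.toLp_const_smul c f.2.2) }

/-- A sesquilinear form on a linear set `D` in a complex Hilbert space,
linear in the first argument and antilinear in the second. -/
abbrev SesqForm {E : Type*} [AddCommGroup E] [Module ℂ E] (D : Submodule ℂ E) : Type _ :=
  D →ₗ[ℂ] D →ₗ⋆[ℂ] ℂ

section Abstract

variable {E F : Type*} [NormedAddCommGroup E] [InnerProductSpace ℂ E]
  [NormedAddCommGroup F] [InnerProductSpace ℂ F]

/-- The form `(f, g) ↦ (A f, B g)`, linear in `f` and antilinear in `g`. -/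
def productForm {D : Submodule ℂ E} (A B : D →ₗ[ℂ] F) : SesqForm D :=
  LinearMap.mk₂'ₛₗ (RingHom.id ℂ) (starRingEnd ℂ) (fun f g => inner ℂ (B g) (A f))
    (fun f f' g => by rw [map_add, inner_add_right])
    (fun c f g => by rw [map_smul, inner_smul_right, RingHom.id_apply, smul_eq_mul])
    (fun f g g' => by rw [map_add, inner_add_left])
    (fun c f g => by rw [map_smul, inner_smul_left, smul_eq_mul])

/-- The operator associated with a form `h` on `D`: a vector `f ∈ D` is in its domain and is mapped
to `u` when `h[f, g] = (u, g)` for all `g ∈ D`. -/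
def formOperator {D : Submodule ℂ E} (h : SesqForm D) : E →ₗ.[ℂ] E :=
  Submodule.toLinearPMap
    { carrier := {p : E × E | ∃ f : D, (f : E) = p.1 ∧ ∀ g : D, h f g = inner ℂ (g : E) p.2}
      add_mem' := by
        rintro p q ⟨f, hf, hf'⟩ ⟨f₁, hf₁, hf₁'⟩
        refine ⟨f + f₁, by simp [hf, hf₁], fun g => ?_⟩
        rw [map_add, LinearMap.add_apply, hf' g, hf₁' g, Prod.snd_add, inner_add_right]
      zero_mem' := ⟨0, by simp, fun g => by simp⟩
      smul_mem' := by
        rintro c p ⟨f, hf, hf'⟩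
        refine ⟨c • f, by simp [hf], fun g => ?_⟩
        rw [map_smul, LinearMap.smul_apply, hf' g, Prod.smul_snd, inner_smul_right, smul_eq_mul] }

/-- The negative index of a (real-valued on the diagonal) form `h` on `D`: the maximal dimension
of linear sets `K ⊆ D` with `h[f, f] < 0` for all nonzero `f ∈ K`. -/
def negIndex {D : Submodule ℂ E} (h : SesqForm D) : ℕ∞ :=
  ⨆ (K : Submodule ℂ D) (_ : ∀ f ∈ K, f ≠ 0 → (h f f).re < 0),
    Cardinal.toENat (Module.rank ℂ K)

/-- The eigenspace `{f ∈ D(T) : T f = μ f}` of an unbounded operator. -/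
def eigenspace (T : E →ₗ.[ℂ] E) (μ : ℂ) : Submodule ℂ E where
  carrier := {f | ∃ hf : f ∈ T.domain, T ⟨f, hf⟩ = μ • f}
  add_mem' := by
    rintro f g ⟨hf, hf'⟩ ⟨hg, hg'⟩
    refine ⟨T.domain.add_mem hf hg, ?_⟩
    rw [smul_add, ← hf', ← hg', ← T.map_add]
    rfl
  zero_mem' := ⟨T.domain.zero_mem, by rw [smul_zero]; exact T.map_zero⟩
  smul_mem' := by
    rintro c f ⟨hf, hf'⟩
    refine ⟨T.domain.smul_mem c hf, ?_⟩
    rw [smul_comm, ← hf', ← T.map_smul]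
    rfl

/-- The total number of strictly negative eigenvalues, counted with multiplicity. -/
def negEigenvalueCount (T : E →ₗ.[ℂ] E) : ℕ∞ :=
  ∑' μ : Set.Iio (0 : ℝ), Cardinal.toENat (Module.rank ℂ (eigenspace T ((μ : ℝ) : ℂ)))

end Abstract

/-- The form `h₀[f, g] = ∫₀^∞ (𝖫 f)(x) conj((𝖫 g)(x)) σ₀(x) dx` on the set of all `f ∈ L²(0, ∞)`
with `∫₀^∞ |(𝖫 f)(x)|² σ₀(x) dx < ∞`. -/
def unperturbedForm (σ₀ : ℝ → ℝ) : SesqForm (laplaceDomain σ₀) :=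
  productForm (laplaceOperator σ₀).toFun (laplaceOperator σ₀).toFun

/-- The domain of the perturbed form: the domain of `h₀` intersected with that of `V`
(the latter is the whole space when `V` is bounded). -/
def perturbedFormDomain (σ₀ : ℝ → ℝ) (v : ℝ → ℂ) : Submodule ℂ L2 :=
  laplaceDomain σ₀ ⊓ hankelDomain v

/-- The form `h[f, g] = h₀[f, g] + (V f, g)`, with `V` the Hankel operator with kernel `v`. -/
def perturbedForm (σ₀ : ℝ → ℝ) (v : ℝ → ℂ) : SesqForm (perturbedFormDomain σ₀ v) :=
  productForm ((laplaceOperator σ₀).toFun ∘ₗ Submodule.inclusion inf_le_left)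
      ((laplaceOperator σ₀).toFun ∘ₗ Submodule.inclusion inf_le_left) +
    productForm ((hankelOperator v).toFun ∘ₗ Submodule.inclusion inf_le_right)
      (perturbedFormDomain σ₀ v).subtype

/-- The kernel `v(t) = ∑ₘ Pₘ(t) e^{-βₘ t}`. -/
def expPolyKernel {M : ℕ} (β : Fin M → ℂ) (P : Fin M → ℂ[X]) (t : ℝ) : ℂ :=
  ∑ m, (P m).eval (t : ℂ) * Complex.exp (-(β m) * t)

/-- The number `𝒩` attached to a polynomial `P ≠ 0` with real coefficients, of degree `K`: it is
`(K + 1) / 2` for odd `K`, and for even `K` it is `K / 2` or `K / 2 + 1` according as the leading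
coefficient is positive or negative. -/
def realTermCount (P : ℂ[X]) : ℕ :=
  if Odd P.natDegree then (P.natDegree + 1) / 2
  else if 0 < P.leadingCoeff.re then P.natDegree / 2
  else P.natDegree / 2 + 1

/-- The total count: `𝒩ₘ` for every real `βₘ`, and `Kₘ + 1` for every pair of complex conjugate
exponents (represented by its member in the upper half-plane). -/
def totalCount {M : ℕ} (β : Fin M → ℂ) (P : Fin M → ℂ[X]) : ℕ :=
  ∑ m with (β m).im = 0, realTermCount (P m) + ∑ m with 0 < (β m).im, ((P m).natDegree + 1)

end Hankel

end

/-!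
Write `L` for the Laplace transform into `L²(σ₀(x) dx)`, so that `h₀[f, f] = ‖L f‖²`. The kernel
is separated: with the coordinates `ℓ_{m,k}(f) = ∫ t ^ k e^{-βₘ t} f(t) dt`, `k ≤ Kₘ`, the form
`(V f, f)` is `Φ(ℓ(f))` for an explicit Hermitian matrix `Φ` (`kernelMatrix`), so that `V` is
bounded and of finite rank.

*Self-adjointness.* `L` is closed (`isClosed_laplaceOperator`) and densely defined
(`dense_laplaceDomain`), so orthogonal projection onto its graph inverts the operator of
`h₀ + c` for every `c > 0`, and a Neumann series inverts that of `h + c` for large `c`. A symmetric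
operator with such a resolvent is self-adjoint (`IsFormResolvent.isSelfAdjoint`).

*The matrix.* A real exponent contributes to `Φ` a skew-triangular block with entries
`binom(j + k, j) p_{j + k}`, which vanish for `j + k > K`; a conjugate pair of exponents contributes two
such blocks in off-diagonal position. `Φ` is nondegenerate (`kernelMatrix_injective`), it is
nonnegative on a coordinate subspace whose codimension is the number `n` claimed in the theorem,
and it is nonpositive on a coordinate subspace whose codimension is the complementary number
(`matrixForm_nonneg`, `matrixForm_nonpos`). Hence `Φ` has exactly `n` negative eigenvalues.

*The negative index of `h`.* Since `h₀ ≥ 0`, a subspace on which `h < 0` is mapped injectively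
to `ℂ ^ n` by the `n` coordinates just mentioned, which gives the upper bound. For the lower
bound the coordinates `ℓ(f)` are prescribed as the negative eigenvectors of `Φ`, with `‖L f‖`
arbitrarily small. This is possible because no nontrivial combination of the `ℓ_{m,k}` is
bounded by `‖L f‖` (`expPoly_sum_eq_zero_of_bounded`): otherwise an exponential polynomial would
be the Laplace transform of an absolutely continuous measure; it satisfies a linear recurrence,
which amounts to multiplying the density by a polynomial in `e^{-x}`, and uniqueness in the
moment problem shows that the density is zero.

*Eigenvalues.* For the resolvent `B` of `h` at `-c`, the operator `1/c - B` is `P² - N²` with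
`P N = 0`, by the continuous functional calculus. The form `h` is negative on the image under `B`
of the range of `N` and nonnegative on the kernel of `N`, so the dimension of the range of `N`
is the negative index of `h`. Being finite-dimensional and invariant under `B`, this range has a
basis of eigenvectors, and it contains every eigenvector with a negative eigenvalue
(`IsNegPart.negEigenvalueCount_eq`).
-/

noncomputable section

namespace Hankel

/-! ### Operators associated with semibounded forms -/

section FormResolvent

variable {E F : Type*} [NormedAddCommGroup E] [InnerProductSpace ℂ E]
  [NormedAddCommGroup F] [InnerProductSpace ℂ F]

/-- The form `h` is densely defined and Hermitian, `h + c` is coercive, and the bounded operator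
`B` is the inverse of the operator associated with `h + c`. -/
structure IsFormResolvent {D : Submodule ℂ E} (h : SesqForm D) (c : ℝ) (B : E →L[ℂ] E) :
    Prop where
  dense : Dense (D : Set E)
  pos : 0 < c
  hermitian : ∀ f g, h f g = conj (h g f)
  coercive : ∃ ε : ℝ, 0 < ε ∧ ∀ f : D, ε * ‖(f : E)‖ ^ 2 ≤ (h f f).re + c * ‖(f : E)‖ ^ 2
  resolvent : ∀ u, ∃ f : D, (f : E) = B u ∧
    ∀ g : D, h f g + c * inner ℂ (g : E) (f : E) = inner ℂ (g : E) u

theorem eq_of_forall_inner_eq {D : Submodule ℂ E} (hD : Dense (D : Set E)) {u v : E}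
    (h : ∀ g : D, inner ℂ (g : E) u = inner ℂ (g : E) v) : u = v :=
  hD.eq_of_inner_right ℂ fun g hg => h ⟨g, hg⟩

theorem mem_graph_formOperator {D : Submodule ℂ E} (hD : Dense (D : Set E)) (h : SesqForm D)
    (p : E × E) : p ∈ (formOperator h).graph ↔
      ∃ f : D, (f : E) = p.1 ∧ ∀ g : D, h f g = inner ℂ (g : E) p.2 := by
  unfold formOperator
  rw [Submodule.toLinearPMap_graph_eq]
  · rfl
  · rintro ⟨x, y⟩ ⟨f, hf, hf'⟩ (rfl : x = 0)
    obtain rfl : f = 0 := by simpa using hf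
    exact eq_of_forall_inner_eq hD fun g => by simpa using (hf' g).symm

theorem formOperator_apply_eq_iff {D : Submodule ℂ E} (hD : Dense (D : Set E)) (h : SesqForm D)
    (x u : E) : (∃ hx : x ∈ (formOperator h).domain, formOperator h ⟨x, hx⟩ = u) ↔
      ∃ f : D, (f : E) = x ∧ ∀ g : D, h f g = inner ℂ (g : E) u := by
  rw [← mem_graph_formOperator hD h (x, u), LinearPMap.mem_graph_iff]
  constructor
  · rintro ⟨hx, hu⟩
    exact ⟨⟨x, hx⟩, rfl, hu⟩
  · rintro ⟨⟨y, hy⟩, rfl, hu⟩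
    exact ⟨hy, hu⟩

theorem formOperator_spec {D : Submodule ℂ E} (hD : Dense (D : Set E)) (h : SesqForm D)
    (x : (formOperator h).domain) :
    ∃ f : D, (f : E) = x ∧ ∀ g : D, h f g = inner ℂ (g : E) (formOperator h x) :=
  (formOperator_apply_eq_iff hD h x (formOperator h x)).1 ⟨x.2, rfl⟩

namespace IsFormResolvent

variable {D : Submodule ℂ E} {h : SesqForm D} {c : ℝ} {B : E →L[ℂ] E}

theorem eq_apply (hB : IsFormResolvent h c B) (f : D) (u : E)
    (hf : ∀ g : D, h f g + c * inner ℂ (g : E) (f : E) = inner ℂ (g : E) u) : (f : E) = B u := by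
  obtain ⟨f', hf', hf''⟩ := hB.resolvent u
  obtain ⟨ε, hε, hc⟩ := hB.coercive
  have h1 : h (f - f') (f - f') + c * inner ℂ ((f - f' : D) : E) ((f - f' : D) : E) = 0 := by
    have e1 := hf (f - f')
    have e2 := hf'' (f - f')
    have e3 : h (f - f') (f - f') = h f (f - f') - h f' (f - f') := by
      rw [map_sub h f f', LinearMap.sub_apply]
    have e4 : inner ℂ ((f - f' : D) : E) ((f - f' : D) : E) =
        inner ℂ ((f - f' : D) : E) (f : E) - (inner ℂ ((f - f' : D) : E) (f' : E) : ℂ) := by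
      rw [← inner_sub_right, ← Submodule.coe_sub]
    rw [e3, e4]
    linear_combination e1 - e2
  have h2 := hc (f - f')
  have h3 := congrArg Complex.re h1
  rw [inner_self_eq_norm_sq_to_K, Complex.add_re] at h3
  have h4 : ((c : ℂ) * ((‖((f - f' : D) : E)‖ : ℂ)) ^ 2).re = c * ‖((f - f' : D) : E)‖ ^ 2 := by
    rw [← Complex.ofReal_pow, ← Complex.ofReal_mul, Complex.ofReal_re]
  erw [h4] at h3
  rw [h3, Complex.zero_re] at h2
  have h5 : ‖((f - f' : D) : E)‖ = 0 := by
    by_contra hne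
    have : 0 < ‖((f - f' : D) : E)‖ ^ 2 := by positivity
    nlinarith
  rw [← hf', ← sub_eq_zero, ← Submodule.coe_sub]
  exact norm_eq_zero.1 h5

/-- The resolvent parametrizes the graph of the operator associated with the form. -/
theorem formOperator_apply_eq_iff (hB : IsFormResolvent h c B) (x u : E) :
    (∃ hx : x ∈ (formOperator h).domain, formOperator h ⟨x, hx⟩ = u) ↔
      x = B (u + (c : ℂ) • x) := by
  rw [Hankel.formOperator_apply_eq_iff hB.dense]
  constructor
  · rintro ⟨f, rfl, hf⟩
    refine hB.eq_apply f _ fun g => ?_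
    rw [hf g, inner_add_right, inner_smul_right]
  · intro hx
    obtain ⟨f, hf, hf'⟩ := hB.resolvent (u + (c : ℂ) • x)
    have hfx : (f : E) = x := hf.trans hx.symm
    refine ⟨f, hfx, fun g => ?_⟩
    have := hf' g
    rw [inner_add_right, inner_smul_right, hfx] at this
    exact add_right_cancel this

theorem injective (hB : IsFormResolvent h c B) : Function.Injective B := by
  rw [injective_iff_map_eq_zero]
  intro u hu
  obtain ⟨f, hf, hf'⟩ := hB.resolvent u
  obtain rfl : f = 0 := by simpa [hu] using hf
  exact eq_of_forall_inner_eq hB.dense fun g => by simpa using (hf' g).symm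

/-- Symmetry of the resolvent. -/
theorem inner_apply_left (hB : IsFormResolvent h c B) (u v : E) :
    inner ℂ (B u) v = inner ℂ u (B v) := by
  obtain ⟨f, hf, hf'⟩ := hB.resolvent u
  obtain ⟨g, hg, hg'⟩ := hB.resolvent v
  rw [← hf, ← hg, ← hg' f, ← inner_conj_symm u (g : E), ← hf' g, map_add, ← hB.hermitian, map_mul,
    Complex.conj_ofReal, inner_conj_symm]

theorem re_inner_apply (hB : IsFormResolvent h c B) {u : E} {f : D} (hf : (f : E) = B u) :
    (h f f).re + c * ‖(f : E)‖ ^ 2 = (inner ℂ (f : E) u : ℂ).re := by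
  obtain ⟨f', hf1, hf2⟩ := hB.resolvent u
  obtain rfl : f = f' := Subtype.ext (hf.trans hf1.symm)
  rw [← hf2 f, Complex.add_re, inner_self_eq_norm_sq_to_K]
  congr 1
  rw [Complex.re_ofReal_mul]
  congr 1
  norm_cast

theorem apply_mem_domain (hB : IsFormResolvent h c B) (u : E) :
    ∃ hx : B u ∈ (formOperator h).domain,
      formOperator h ⟨B u, hx⟩ = u - (c : ℂ) • B u :=
  (hB.formOperator_apply_eq_iff (B u) (u - (c : ℂ) • B u)).2 (by rw [sub_add_cancel])

theorem dense_domain [CompleteSpace E] (hB : IsFormResolvent h c B) :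
    Dense ((formOperator h).domain : Set E) := by
  rw [Submodule.dense_iff_topologicalClosure_eq_top, Submodule.topologicalClosure_eq_top_iff,
    Submodule.eq_bot_iff]
  intro u hu
  obtain ⟨hx, -⟩ := hB.apply_mem_domain u
  obtain ⟨f, hf, -⟩ := hB.resolvent u
  obtain ⟨ε, hε, hc⟩ := hB.coercive
  have h1 := hB.re_inner_apply hf
  have h2 : inner ℂ (f : E) u = 0 := by
    rw [hf]; exact (Submodule.mem_orthogonal _ _).1 hu _ hx
  have h3 := hc f
  rw [h1, h2, Complex.zero_re] at h3
  refine hB.injective ?_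
  rw [map_zero, ← hf, ← norm_eq_zero]
  by_contra hne
  have : 0 < ‖(f : E)‖ ^ 2 := by positivity
  nlinarith

/-- The operator is symmetric and its sum with `c` is onto, hence it is self-adjoint. -/
theorem isSelfAdjoint [CompleteSpace E] (hB : IsFormResolvent h c B) :
    IsSelfAdjoint (formOperator h) := by
  have hd := hB.dense_domain
  rw [LinearPMap.isSelfAdjoint_def]
  refine le_antisymm (LinearPMap.le_of_le_graph ?_) (LinearPMap.IsFormalAdjoint.le_adjoint hd ?_)
  · rintro ⟨y, w⟩ hy
    rw [LinearPMap.mem_graph_iff] at hy ⊢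
    obtain ⟨y, rfl, hw⟩ := hy
    simp only at hw
    have key : (y : E) = B (w + (c : ℂ) • (y : E)) := by
      refine ext_inner_right ℂ fun v => ?_
      obtain ⟨hx, hx'⟩ := hB.apply_mem_domain v
      have h1 := LinearPMap.adjoint_isFormalAdjoint hd y ⟨B v, hx⟩
      rw [hx', hw, inner_sub_right, inner_smul_right] at h1
      rw [hB.inner_apply_left, inner_add_left, inner_smul_left, Complex.conj_ofReal]
      linear_combination -h1
    obtain ⟨hx, hx'⟩ := (hB.formOperator_apply_eq_iff (y : E) w).2 key
    exact ⟨⟨y, hx⟩, rfl, hx'⟩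
  · intro x y
    obtain ⟨f, hf, hf'⟩ := formOperator_spec hB.dense h x
    obtain ⟨g, hg, hg'⟩ := formOperator_spec hB.dense h y
    rw [← hf, ← hg, ← hg' f, ← inner_conj_symm _ (g : E), ← hf' g, ← hB.hermitian]

theorem norm_apply_le (hB : IsFormResolvent h c B) (hpos : ∀ f, 0 ≤ (h f f).re) (u : E) :
    c * ‖B u‖ ≤ ‖u‖ := by
  obtain ⟨f, hf, -⟩ := hB.resolvent u
  have h1 := hB.re_inner_apply hf
  have h2 := (Complex.re_le_norm _).trans (norm_inner_le_norm (𝕜 := ℂ) (f : E) u)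
  rw [← hf]
  rcases (norm_nonneg (f : E)).eq_or_lt with h0 | h0
  · rw [← h0, mul_zero]; exact norm_nonneg _
  · have h3 := hpos f
    refine le_of_mul_le_mul_left ?_ h0
    nlinarith

end IsFormResolvent

theorem productForm_apply {D : Submodule ℂ E} (A B : D →ₗ[ℂ] F) (f g : D) :
    productForm A B f g = inner ℂ (B g) (A f) := rfl

/-- A nonnegative closed form `(L f, L g)` has a resolvent at every point `-c < 0`: it is given by
orthogonal projection onto the closed subspace `{(√c f, L f)}` of `E × F`. -/
theorem exists_isFormResolvent_productForm [CompleteSpace E] [CompleteSpace F]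
    (L : E →ₗ.[ℂ] F) (hL : L.IsClosed) (hd : Dense (L.domain : Set E)) {c : ℝ} (hc : 0 < c) :
    ∃ B : E →L[ℂ] E, IsFormResolvent (productForm L.toFun L.toFun) c B := by
  set r : ℂ := ((√c : ℝ) : ℂ) with hr
  have hr2 : r * r = c := by rw [hr, ← Complex.ofReal_mul, Real.mul_self_sqrt hc.le]
  have hr0 : r ≠ 0 := by
    rw [hr, Complex.ofReal_ne_zero]; exact (Real.sqrt_pos.2 hc).ne'
  have hrc : conj r = r := Complex.conj_ofReal _
  let J : L.domain →ₗ[ℂ] WithLp 2 (E × F) :=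
    (WithLp.linearEquiv 2 ℂ (E × F)).symm.toLinearMap ∘ₗ
      LinearMap.prod (r • L.domain.subtype) L.toFun
  let G : Submodule ℂ (WithLp 2 (E × F)) := LinearMap.range J
  have hG : IsClosed (G : Set (WithLp 2 (E × F))) := by
    have hcont : Continuous fun p : WithLp 2 (E × F) => (r⁻¹ • p.fst, p.snd) :=
      ((WithLp.continuous_fst 2 E F).const_smul r⁻¹).prodMk (WithLp.continuous_snd 2 E F)
    have : (G : Set (WithLp 2 (E × F))) =
        (fun p : WithLp 2 (E × F) => (r⁻¹ • p.fst, p.snd)) ⁻¹' (L.graph : Set (E × F)) := by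
      ext p
      simp only [Set.mem_preimage, SetLike.mem_coe, LinearPMap.mem_graph_iff, G,
        LinearMap.mem_range]
      constructor
      · rintro ⟨f, rfl⟩
        exact ⟨f, by simp [J, hr0], rfl⟩
      · rintro ⟨f, hf1, hf2⟩
        refine ⟨f, WithLp.ofLp_injective 2 (Prod.ext ?_ hf2)⟩
        change r • (f : E) = p.fst
        rw [hf1, smul_inv_smul₀ hr0]
    rw [this]
    exact IsClosed.preimage hcont hL
  have : CompleteSpace G := hG.completeSpace_coe
  let B : E →L[ℂ] E := r⁻¹ • (WithLp.fstL 2 ℂ E F ∘L G.starProjection ∘L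
    (WithLp.prodContinuousLinearEquiv 2 ℂ E F).symm.toContinuousLinearMap ∘L
    ContinuousLinearMap.inl ℂ E F ∘L (r⁻¹ • ContinuousLinearMap.id ℂ E))
  refine ⟨B, hd, hc, fun f g => ?_, ⟨c, hc, fun f => ?_⟩, fun u => ?_⟩
  · rw [productForm_apply, productForm_apply, inner_conj_symm]
  · rw [productForm_apply]
    have : 0 ≤ (inner ℂ (L.toFun f) (L.toFun f) : ℂ).re := inner_self_nonneg (𝕜 := ℂ)
    linarith
  · let p : WithLp 2 (E × F) := WithLp.toLp 2 (r⁻¹ • u, 0)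
    have hBu : B u = r⁻¹ • (G.starProjection p).fst := rfl
    obtain ⟨f, hf⟩ : G.starProjection p ∈ G := Submodule.starProjection_apply_mem G p
    have hf1 : (G.starProjection p).fst = r • (f : E) := by rw [← hf]; rfl
    have hf2 : (G.starProjection p).snd = L.toFun f := by rw [← hf]; rfl
    refine ⟨f, by rw [hBu, hf1, inv_smul_smul₀ hr0], fun g => ?_⟩
    have horth : inner ℂ (J g) (p - G.starProjection p) = 0 :=
      (Submodule.mem_orthogonal _ _).1 (G.sub_starProjection_mem_orthogonal p) _ ⟨g, rfl⟩
    have e : inner ℂ (J g) (p - G.starProjection p) =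
        inner ℂ (r • (g : E)) (r⁻¹ • u - r • (f : E)) + inner ℂ (L.toFun g) (0 - L.toFun f) := by
      rw [← hf]; rfl
    rw [e, inner_sub_right, inner_sub_right, inner_smul_left, inner_smul_left, inner_smul_right,
      inner_smul_right, inner_zero_right, hrc] at horth
    rw [productForm_apply]
    field_simp at horth
    linear_combination -horth - hr2 * inner ℂ (g : E) (f : E)

/-- Perturbation of a nonnegative form by a bounded symmetric operator `V`: if `B₀` is the resolvent
of `h₀`, then `B₀ (1 + V B₀)⁻¹` is the one of `h₀ + V`, the inverse being a Neumann series. -/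
theorem exists_isFormResolvent_add [CompleteSpace E] {D : Submodule ℂ E} {h h₀ : SesqForm D}
    (V : E →L[ℂ] E) (hV : ∀ f g, inner ℂ (V f) g = inner ℂ f (V g))
    (hh : ∀ f g : D, h f g = h₀ f g + inner ℂ (g : E) (V f))
    (hpos : ∀ f, 0 ≤ (h₀ f f).re) {c : ℝ} (hc : ‖V‖ < c) {B₀ : E →L[ℂ] E}
    (hB₀ : IsFormResolvent h₀ c B₀) : ∃ B : E →L[ℂ] E, IsFormResolvent h c B := by
  have hc0 : 0 < c := hB₀.pos
  have hn : ‖-(V ∘L B₀)‖ < 1 := by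
    have hB : ‖B₀‖ ≤ 1 / c := by
      refine ContinuousLinearMap.opNorm_le_bound _ (by positivity) fun u => ?_
      have := hB₀.norm_apply_le hpos u
      rw [one_div, ← div_eq_inv_mul, le_div_iff₀ hc0]
      linarith
    rw [norm_neg]
    calc ‖V ∘L B₀‖ ≤ ‖V‖ * ‖B₀‖ := ContinuousLinearMap.opNorm_comp_le _ _
      _ ≤ ‖V‖ * (1 / c) := by gcongr
      _ < 1 := by rw [mul_one_div, div_lt_one hc0]; exact hc
  let U := Units.oneSub (-(V ∘L B₀)) hn
  have hU (u : E) : (↑U⁻¹ : E →L[ℂ] E) u + V (B₀ ((↑U⁻¹ : E →L[ℂ] E) u)) = u := by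
    have h1 : (U : E →L[ℂ] E) * (↑U⁻¹ : E →L[ℂ] E) = 1 := U.mul_inv
    have h2 := congrArg (fun T : E →L[ℂ] E => T u) h1
    simpa [U] using h2
  have hVre (f : E) : -(‖V‖ * ‖f‖ ^ 2) ≤ (inner ℂ f (V f) : ℂ).re := by
    have h1 := (abs_le.1 ((Complex.abs_re_le_norm _).trans
      (norm_inner_le_norm (𝕜 := ℂ) f (V f)))).1
    have h2 := V.le_opNorm f
    nlinarith [norm_nonneg f]
  refine ⟨B₀ ∘L (↑U⁻¹ : E →L[ℂ] E), hB₀.dense, hc0, fun f g => ?_,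
    ⟨c - ‖V‖, by linarith, fun f => ?_⟩, fun u => ?_⟩
  · rw [hh, hh, map_add, ← hB₀.hermitian, inner_conj_symm, hV]
  · rw [hh, Complex.add_re]
    linarith [hpos f, hVre f]
  · obtain ⟨f, hf, hf'⟩ := hB₀.resolvent ((↑U⁻¹ : E →L[ℂ] E) u)
    refine ⟨f, hf, fun g => ?_⟩
    have h1 := hf' g
    have h2 := hU u
    rw [← hf] at h2
    rw [hh]
    have h3 := congrArg (fun x => (inner ℂ (g : E) x : ℂ)) h2
    simp only [inner_add_right] at h3
    linear_combination h1 + h3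

end FormResolvent

/-! ### Negative index and negative eigenvalues -/

section NegativeSpectrum

variable {E : Type*} [NormedAddCommGroup E] [InnerProductSpace ℂ E]

/-- A self-adjoint operator is the difference of the squares of two commuting self-adjoint operators
with zero product: `P = √(A⁺)` and `N = √(A⁻)`. -/
theorem exists_eq_sq_sub_sq [CompleteSpace E] (A : E →L[ℂ] E) (hA : IsSelfAdjoint A) :
    ∃ P N : E →L[ℂ] E, (∀ x y, inner ℂ (P x) y = inner ℂ x (P y)) ∧
      (∀ x y, inner ℂ (N x) y = inner ℂ x (N y)) ∧ (∀ x, P (N x) = 0) ∧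
      (∀ x, N (P x) = 0) ∧ ∀ x, A x = P (P x) - N (N x) := by
  let p : ℝ → ℝ := fun x => √x
  let n : ℝ → ℝ := fun x => √(-x)
  have hp : Continuous p := by fun_prop
  have hn : Continuous n := by fun_prop
  have hpn : (fun x => p x * n x) = fun _ => (0 : ℝ) := by
    funext x
    rcases le_total x 0 with hx | hx
    · simp [p, Real.sqrt_eq_zero_of_nonpos hx]
    · simp [n, Real.sqrt_eq_zero_of_nonpos (neg_nonpos.2 hx)]
  have hnp : (fun x => n x * p x) = fun _ => (0 : ℝ) := by
    rw [← hpn]; funext x; ring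
  have hsub : (fun x => p x * p x - n x * n x) = fun x => x := by
    funext x
    rcases le_total x 0 with hx | hx
    · simp [p, n, Real.sqrt_eq_zero_of_nonpos hx, Real.mul_self_sqrt (neg_nonneg.2 hx)]
    · simp [p, n, Real.sqrt_eq_zero_of_nonpos (neg_nonpos.2 hx), Real.mul_self_sqrt hx]
  have hz : cfc (fun _ : ℝ => (0 : ℝ)) A = 0 := by
    simp
  have hPN : cfc p A * cfc n A = 0 := by
    rw [← cfc_mul p n A hp.continuousOn hn.continuousOn, hpn, hz]
  have hNP : cfc n A * cfc p A = 0 := by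
    rw [← cfc_mul n p A hn.continuousOn hp.continuousOn, hnp, hz]
  have hdec : cfc p A * cfc p A - cfc n A * cfc n A = A := by
    rw [← cfc_mul p p A hp.continuousOn hp.continuousOn,
      ← cfc_mul n n A hn.continuousOn hn.continuousOn,
      ← cfc_sub _ _ A (by fun_prop) (by fun_prop), hsub, cfc_id' ℝ A]
  refine ⟨cfc p A, cfc n A, ?_, ?_, fun x => ?_, fun x => ?_, fun x => ?_⟩
  · exact ContinuousLinearMap.isSelfAdjoint_iff_isSymmetric.1 (cfc_predicate p A)
  · exact ContinuousLinearMap.isSelfAdjoint_iff_isSymmetric.1 (cfc_predicate n A)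
  · exact congrArg (fun T : E →L[ℂ] E => T x) hPN
  · exact congrArg (fun T : E →L[ℂ] E => T x) hNP
  · exact (congrArg (fun T : E →L[ℂ] E => T x) hdec).symm

theorem rank_le_negIndex {D : Submodule ℂ E} {h : SesqForm D} (K : Submodule ℂ D)
    (hK : ∀ f ∈ K, f ≠ 0 → (h f f).re < 0) :
    Cardinal.toENat (Module.rank ℂ K) ≤ negIndex h :=
  le_iSup₂ (f := fun (K : Submodule ℂ D) (_ : ∀ f ∈ K, f ≠ 0 → (h f f).re < 0) =>
    Cardinal.toENat (Module.rank ℂ K)) K hK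

theorem negIndex_le {D : Submodule ℂ E} {h : SesqForm D} {n : ℕ∞}
    (hn : ∀ K : Submodule ℂ D, (∀ f ∈ K, f ≠ 0 → (h f f).re < 0) →
      Cardinal.toENat (Module.rank ℂ K) ≤ n) : negIndex h ≤ n :=
  iSup₂_le hn

theorem re_inner_self (x : E) : (inner ℂ x x : ℂ).re = ‖x‖ ^ 2 := by
  rw [inner_self_eq_norm_sq_to_K]
  norm_cast

/-- The data `A = 1/c - B = P² - N²` attached to a form resolvent `B` at `-c`. The range of `N` is
the spectral subspace of the operator associated with `h` for the interval `(-∞, 0)`. -/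
structure IsNegPart {D : Submodule ℂ E} (h : SesqForm D) (c : ℝ) (B P N : E →L[ℂ] E) : Prop where
  resolvent : IsFormResolvent h c B
  symm_P : ∀ x y, inner ℂ (P x) y = inner ℂ x (P y)
  symm_N : ∀ x y, inner ℂ (N x) y = inner ℂ x (N y)
  P_N : ∀ x, P (N x) = 0
  N_P : ∀ x, N (P x) = 0
  eq : ∀ x, B x = (c : ℂ)⁻¹ • x - (P (P x) - N (N x))

theorem IsFormResolvent.exists_isNegPart [CompleteSpace E] {D : Submodule ℂ E} {h : SesqForm D}
    {c : ℝ} {B : E →L[ℂ] E} (hB : IsFormResolvent h c B) : ∃ P N, IsNegPart h c B P N := by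
  let A : E →L[ℂ] E := (c : ℂ)⁻¹ • ContinuousLinearMap.id ℂ E - B
  have hA : IsSelfAdjoint A := by
    refine ContinuousLinearMap.isSelfAdjoint_iff_isSymmetric.2 fun x y => ?_
    simp [A, inner_sub_left, inner_sub_right, inner_smul_left, inner_smul_right,
      hB.inner_apply_left]
  obtain ⟨P, N, h1, h2, h3, h4, h5⟩ := exists_eq_sq_sub_sq A hA
  refine ⟨P, N, hB, h1, h2, h3, h4, fun x => ?_⟩
  rw [← h5]
  simp [A]

namespace IsNegPart

variable {D : Submodule ℂ E} {h : SesqForm D} {c : ℝ} {B P N : E →L[ℂ] E}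

theorem re_inner_P (hN : IsNegPart h c B P N) (x : E) :
    (inner ℂ x (P (P x)) : ℂ).re = ‖P x‖ ^ 2 := by
  rw [← hN.symm_P, re_inner_self]

theorem re_inner_N (hN : IsNegPart h c B P N) (x : E) :
    (inner ℂ x (N (N x)) : ℂ).re = ‖N x‖ ^ 2 := by
  rw [← hN.symm_N, re_inner_self]

/-- On the range of `N`, the operator `A = 1/c - B` is negative, so that `h[B g, B g] < 0`. -/
theorem form_neg (hN : IsNegPart h c B P N) {f : D} {u : E} (hf : (f : E) = B (N u))
    (hu : N u ≠ 0) : (h f f).re < 0 := by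
  have hc := hN.resolvent.pos
  have hcc : (c : ℂ) ≠ 0 := by exact_mod_cast hc.ne'
  have h1 := hN.resolvent.re_inner_apply hf
  have hNu : N (N u) ≠ 0 := fun h0 => hu <| by
    have := hN.re_inner_N u
    rw [h0, inner_zero_right, Complex.zero_re] at this
    simpa using this.symm
  set g := N u with hg
  have hf' : (f : E) = (c : ℂ)⁻¹ • g + N (N g) := by
    rw [hf, hN.eq, hg, hN.P_N, map_zero, zero_sub, sub_neg_eq_add]
  have h2 : (inner ℂ (f : E) g : ℂ).re = c⁻¹ * ‖g‖ ^ 2 + ‖N g‖ ^ 2 := by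
    rw [hf', inner_add_left, Complex.add_re, inner_smul_left, map_inv₀, Complex.conj_ofReal,
      ← Complex.ofReal_inv, Complex.re_ofReal_mul, re_inner_self, hN.symm_N, re_inner_self]
  have h3 : ‖(f : E)‖ ^ 2 = c⁻¹ ^ 2 * ‖g‖ ^ 2 + 2 * (c⁻¹ * ‖N g‖ ^ 2) + ‖N (N g)‖ ^ 2 := by
    rw [hf', norm_add_sq (𝕜 := ℂ), norm_smul, inner_smul_left, map_inv₀, Complex.conj_ofReal,
      ← Complex.ofReal_inv]
    change _ + 2 * ((c⁻¹ : ℝ) * inner ℂ g (N (N g)) : ℂ).re + _ = _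
    rw [Complex.re_ofReal_mul, hN.re_inner_N, Complex.norm_real, Real.norm_eq_abs,
      abs_of_pos (by positivity)]
    ring
  rw [h2, h3] at h1
  have h4 : 0 < ‖N g‖ ^ 2 := by have := norm_pos_iff.2 hNu; positivity
  have h5 : (h f f).re = -‖N g‖ ^ 2 - c * ‖N (N g)‖ ^ 2 := by
    field_simp at h1
    exact mul_right_cancel₀ hc.ne' (by linear_combination h1)
  have : 0 ≤ c * ‖N (N g)‖ ^ 2 := by positivity
  linarith

/-- The form is nonnegative on the kernel of `N`. -/
theorem form_nonneg (hN : IsNegPart h c B P N) {f : D} (hf : N f = 0) : 0 ≤ (h f f).re := by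
  have hc := hN.resolvent.pos
  obtain ⟨ε, hε, hco⟩ := hN.resolvent.coercive
  obtain ⟨b, hb, hb'⟩ := hN.resolvent.resolvent f
  -- expand the nonnegative quantity `(h + c)[f - c B f]`
  have h0 := hco (f - (c : ℂ) • b)
  have hbf := congrArg Complex.re (hb' f)
  have hbb := hN.resolvent.re_inner_apply hb
  have hfb : (h f b).re = (h b f).re := by rw [hN.resolvent.hermitian f b, Complex.conj_re]
  have hin : (inner ℂ (b : E) (f : E) : ℂ).re = c⁻¹ * ‖(f : E)‖ ^ 2 - ‖P f‖ ^ 2 := by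
    rw [hb, hN.eq, hf, map_zero, sub_zero, inner_sub_left, Complex.sub_re, inner_smul_left,
      map_inv₀, Complex.conj_ofReal, ← Complex.ofReal_inv, Complex.re_ofReal_mul, re_inner_self,
      hN.symm_P, re_inner_self]
  have hin' : (inner ℂ (f : E) (b : E) : ℂ).re = c⁻¹ * ‖(f : E)‖ ^ 2 - ‖P f‖ ^ 2 := by
    rw [← hin, ← inner_conj_symm, Complex.conj_re]
  have e1 : (h (f - (c : ℂ) • b) (f - (c : ℂ) • b)).re =
      (h f f).re - 2 * (c * (h b f).re) + c ^ 2 * (h b b).re := by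
    simp only [map_sub, map_smulₛₗ, LinearMap.sub_apply, LinearMap.smul_apply, Complex.conj_ofReal,
      smul_eq_mul, RingHom.id_apply, Complex.sub_re, Complex.re_ofReal_mul, hfb]
    ring
  have e2 : ‖((f - (c : ℂ) • b : D) : E)‖ ^ 2 =
      ‖(f : E)‖ ^ 2 - 2 * (c * (inner ℂ (f : E) (b : E) : ℂ).re) + c ^ 2 * ‖(b : E)‖ ^ 2 := by
    rw [Submodule.coe_sub, Submodule.coe_smul, norm_sub_sq (𝕜 := ℂ), inner_smul_right, norm_smul]
    change _ - 2 * ((c : ℂ) * inner ℂ (f : E) (b : E)).re + _ = _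
    rw [Complex.re_ofReal_mul, Complex.norm_real, Real.norm_eq_abs, mul_pow, sq_abs]
  rw [Complex.add_re, Complex.re_ofReal_mul, re_inner_self] at hbf
  have h00 : 0 ≤ ε * ‖((f - (c : ℂ) • b : D) : E)‖ ^ 2 := by positivity
  rw [e1, e2] at h0
  rw [e2] at h00
  rw [hin] at hbb
  have hP : 0 ≤ c ^ 2 * ‖P f‖ ^ 2 := by positivity
  have hcc : c * c⁻¹ = 1 := mul_inv_cancel₀ hc.ne'
  have e3 : (h f f).re = ((h f f).re - 2 * (c * (h b f).re) + c ^ 2 * (h b b).re +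
      c * (‖(f : E)‖ ^ 2 - 2 * (c * (inner ℂ (f : E) (b : E) : ℂ).re) + c ^ 2 * ‖(b : E)‖ ^ 2)) +
      c ^ 2 * ‖P f‖ ^ 2 := by
    linear_combination 2 * c * hbf - c ^ 2 * hbb - c * ‖(f : E)‖ ^ 2 * hcc
  rw [e3]
  linarith

theorem rank_le_rank_range (hN : IsNegPart h c B P N) (K : Submodule ℂ D)
    (hK : ∀ f ∈ K, f ≠ 0 → (h f f).re < 0) :
    Module.rank ℂ K ≤ Module.rank ℂ (LinearMap.range (N : E →ₗ[ℂ] E)) := by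
  let φ : K →ₗ[ℂ] LinearMap.range (N : E →ₗ[ℂ] E) :=
    (N : E →ₗ[ℂ] E).rangeRestrict ∘ₗ D.subtype ∘ₗ K.subtype
  refine LinearMap.rank_le_of_injective φ ((injective_iff_map_eq_zero φ).2 fun f hf => ?_)
  by_contra hne
  have h1 : N ((f : D) : E) = 0 := congrArg Subtype.val hf
  have h2 := hN.form_nonneg h1
  have h3 := hK f f.2 (fun h0 => hne (Subtype.ext h0))
  linarith

theorem rank_range_le (hN : IsNegPart h c B P N) :
    Cardinal.toENat (Module.rank ℂ (LinearMap.range (N : E →ₗ[ℂ] E))) ≤ negIndex h := by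
  let R := LinearMap.range (N : E →ₗ[ℂ] E)
  have hD (g : E) : B g ∈ D := by
    obtain ⟨f, hf, -⟩ := hN.resolvent.resolvent g
    rw [← hf]; exact f.2
  let φ : R →ₗ[ℂ] D := ((B : E →ₗ[ℂ] E).codRestrict D hD) ∘ₗ R.subtype
  have hφ : Function.Injective φ := fun x y hxy =>
    Subtype.ext (hN.resolvent.injective (congrArg Subtype.val hxy))
  rw [(LinearEquiv.ofInjective φ hφ).rank_eq]
  refine rank_le_negIndex _ ?_
  rintro _ ⟨⟨_, u, rfl⟩, rfl⟩ hne
  refine hN.form_neg (u := u) rfl fun h0 => hne ?_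
  have : (⟨N u, u, rfl⟩ : R) = 0 := Subtype.ext h0
  exact (congrArg φ this).trans (map_zero φ)

theorem negIndex_eq (hN : IsNegPart h c B P N) :
    negIndex h = Cardinal.toENat (Module.rank ℂ (LinearMap.range (N : E →ₗ[ℂ] E))) :=
  le_antisymm (negIndex_le fun K hK => OrderHomClass.mono _ (hN.rank_le_rank_range K hK))
    hN.rank_range_le

theorem mem_eigenspace_iff (hN : IsNegPart h c B P N) (μ : ℝ) (g : E) :
    g ∈ eigenspace (formOperator h) (μ : ℂ) ↔ g = ((μ + c : ℝ) : ℂ) • B g := by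
  change (∃ hf : g ∈ (formOperator h).domain, formOperator h ⟨g, hf⟩ = (μ : ℂ) • g) ↔ _
  rw [hN.resolvent.formOperator_apply_eq_iff, ← add_smul, map_smul, Complex.ofReal_add]

theorem shift_pos (hN : IsNegPart h c B P N) {μ : ℝ} {g : E} (hg : g ≠ 0)
    (hgμ : g ∈ eigenspace (formOperator h) (μ : ℂ)) : 0 < μ + c := by
  rw [hN.mem_eigenspace_iff] at hgμ
  obtain ⟨f, hf, -⟩ := hN.resolvent.resolvent g
  obtain ⟨ε, hε, hco⟩ := hN.resolvent.coercive
  have h1 := hN.resolvent.re_inner_apply hf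
  have h2 := hco f
  rw [h1] at h2
  rw [← hf] at hgμ
  rw [hgμ] at h2
  rw [inner_smul_right, Complex.re_ofReal_mul, re_inner_self] at h2
  have h3 : 0 < ‖(f : E)‖ := norm_pos_iff.2 fun h0 => hg (by rw [hgμ, h0, smul_zero])
  have h4 : 0 < ‖(f : E)‖ ^ 2 := by positivity
  have := le_of_mul_le_mul_right h2 h4
  linarith

/-- Eigenvectors with negative eigenvalues lie in the range of `N`. -/
theorem eigenspace_le_range (hN : IsNegPart h c B P N) {μ : ℝ} (hμ : μ < 0) :
    eigenspace (formOperator h) (μ : ℂ) ≤ LinearMap.range (N : E →ₗ[ℂ] E) := by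
  intro g hg
  by_cases hg0 : g = 0
  · rw [hg0]; exact Submodule.zero_mem _
  have hpos := hN.shift_pos hg0 hg
  have hc := hN.resolvent.pos
  rw [hN.mem_eigenspace_iff] at hg
  have hne : ((μ + c : ℝ) : ℂ) ≠ 0 := by exact_mod_cast hpos.ne'
  have hcc : (c : ℂ) ≠ 0 := by exact_mod_cast hc.ne'
  have hBg : B g = (((μ + c)⁻¹ : ℝ) : ℂ) • g := by
    nth_rewrite 2 [hg]
    rw [smul_smul, Complex.ofReal_inv, inv_mul_cancel₀ hne, one_smul]
  set a : ℝ := c⁻¹ - (μ + c)⁻¹ with ha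
  have ha0 : a < 0 := by
    rw [ha, sub_neg]
    exact inv_strictAnti₀ hpos (by linarith)
  have key : P (P g) - N (N g) = (a : ℂ) • g := by
    have := hN.eq g
    rw [hBg] at this
    rw [ha, Complex.ofReal_sub, sub_smul, this, Complex.ofReal_inv]
    abel
  have hPg : P g = 0 := by
    have h1 : P (P (P g)) = (a : ℂ) • P g := by
      rw [← map_smul, ← key, map_sub, hN.P_N, sub_zero]
    have h2 := hN.re_inner_P (P g)
    rw [h1, inner_smul_right, Complex.re_ofReal_mul, re_inner_self] at h2
    by_contra hne'
    have h3 : 0 < ‖P g‖ ^ 2 := by have := norm_pos_iff.2 hne'; positivity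
    nlinarith [sq_nonneg ‖P (P g)‖]
  rw [hPg, map_zero, zero_sub] at key
  refine ⟨-(a : ℂ)⁻¹ • N g, ?_⟩
  have hac : (a : ℂ) ≠ 0 := by exact_mod_cast ha0.ne
  change N (-(a : ℂ)⁻¹ • N g) = g
  rw [map_smul, neg_smul, ← smul_neg, key, inv_smul_smul₀ hac]

/-- The restriction of the resolvent to the finite-dimensional range of `N` is diagonalizable; its
eigenvectors are precisely the eigenvectors with negative eigenvalues of the operator
associated with `h`. -/
theorem negEigenvalueCount_eq (hN : IsNegPart h c B P N)
    [FiniteDimensional ℂ (LinearMap.range (N : E →ₗ[ℂ] E))] :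
    negEigenvalueCount (formOperator h) =
      (Module.finrank ℂ (LinearMap.range (N : E →ₗ[ℂ] E)) : ℕ∞) := by
  classical
  set R := LinearMap.range (N : E →ₗ[ℂ] E) with hR
  have hc := hN.resolvent.pos
  have hBR : ∀ g ∈ R, (B : E →ₗ[ℂ] E) g ∈ R := by
    rintro _ ⟨u, rfl⟩
    refine ⟨(c : ℂ)⁻¹ • u + N (N u), ?_⟩
    simp [hN.eq, hN.P_N]
  let BR : R →ₗ[ℂ] R := (B : E →ₗ[ℂ] E).restrict hBR
  have hsymm : BR.IsSymmetric := fun x y => hN.resolvent.inner_apply_left (x : E) (y : E)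
  let b := hsymm.eigenvectorBasis rfl
  let lam := hsymm.eigenvalues rfl
  have hb (i) : B (b i : E) = (lam i : ℂ) • (b i : E) :=
    congrArg Subtype.val (hsymm.apply_eigenvectorBasis rfl i)
  have hbn (i) : ‖(b i : E)‖ = 1 := b.orthonormal.1 i
  have hlam (i) : c⁻¹ < lam i := by
    obtain ⟨u, hu⟩ := (b i).2
    have hu' : N u = (b i : E) := hu
    have hne : N (b i : E) ≠ 0 := fun h0 => by
      have := hN.re_inner_N u
      rw [hu', h0, inner_zero_right, Complex.zero_re, hbn] at this
      norm_num at this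
    have h1 : (inner ℂ (b i : E) (B (b i)) : ℂ).re = c⁻¹ + ‖N (b i : E)‖ ^ 2 := by
      rw [hN.eq]
      have h2 : P (b i : E) = 0 := by rw [← hu', hN.P_N]
      rw [h2, map_zero, zero_sub, sub_neg_eq_add, inner_add_right, Complex.add_re, hN.re_inner_N,
        inner_smul_right, ← Complex.ofReal_inv, Complex.re_ofReal_mul, re_inner_self, hbn]
      ring
    rw [hb, inner_smul_right, Complex.re_ofReal_mul, re_inner_self, hbn] at h1
    have : 0 < ‖N (b i : E)‖ ^ 2 := by have := norm_pos_iff.2 hne; positivity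
    nlinarith
  have hcinv : 0 < c⁻¹ := by positivity
  have hneg (i) : (lam i)⁻¹ - c < 0 := by
    have := inv_strictAnti₀ hcinv (hlam i)
    rw [inv_inv] at this
    linarith
  let μ : Fin (Module.finrank ℂ R) → Set.Iio (0 : ℝ) := fun i => ⟨(lam i)⁻¹ - c, hneg i⟩
  have hspan (ν : Set.Iio (0 : ℝ)) : eigenspace (formOperator h) ((ν : ℝ) : ℂ) =
      Submodule.span ℂ (Set.range fun i : {i // μ i = ν} => (b i : E)) := by
    refine le_antisymm (fun g hg => ?_) (Submodule.span_le.2 ?_)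
    · by_cases hg0 : g = 0
      · rw [hg0]; exact Submodule.zero_mem _
      have hpos := hN.shift_pos hg0 hg
      have hgR := hN.eigenspace_le_range ν.2 hg
      rw [hN.mem_eigenspace_iff] at hg
      have hsum := congrArg Subtype.val (b.sum_repr' ⟨g, hgR⟩)
      simp only [Submodule.coe_sum, Submodule.coe_smul, Submodule.coe_inner] at hsum
      rw [← hsum]
      refine Submodule.sum_mem _ fun i _ => ?_
      by_cases hi : μ i = ν
      · exact Submodule.smul_mem _ _ (Submodule.subset_span ⟨⟨i, hi⟩, rfl⟩)
      · have h1 : inner ℂ (b i : E) g = 0 := by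
          have h2 : inner ℂ (b i : E) g = (((ν : ℝ) + c) * lam i : ℝ) * inner ℂ (b i : E) g := by
            nth_rewrite 1 [hg]
            rw [inner_smul_right, ← hN.resolvent.inner_apply_left, hb, inner_smul_left,
              Complex.conj_ofReal]
            push_cast
            ring
          by_contra hne
          have h3 : (((ν : ℝ) + c) * lam i : ℝ) = 1 := by
            have := mul_right_cancel₀ hne ((one_mul _).trans h2)
            exact_mod_cast this.symm
          apply hi
          apply Subtype.ext
          change (lam i)⁻¹ - c = ν
          rw [← eq_inv_of_mul_eq_one_left h3]
          ring
        rw [h1, zero_smul]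
        exact Submodule.zero_mem _
    · rintro _ ⟨⟨i, rfl⟩, rfl⟩
      change (b i : E) ∈ eigenspace (formOperator h) _
      rw [hN.mem_eigenspace_iff, hb, smul_smul]
      have hl : lam i ≠ 0 := (hcinv.trans (hlam i)).ne'
      have : (((μ i : ℝ) + c : ℝ) : ℂ) * (lam i : ℂ) = 1 := by
        rw [← Complex.ofReal_mul, Complex.ofReal_eq_one]
        change ((lam i)⁻¹ - c + c) * lam i = 1
        rw [sub_add_cancel, inv_mul_cancel₀ hl]
      rw [this, one_smul]
  have hli : LinearIndependent ℂ fun i => (b i : E) :=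
    b.orthonormal.linearIndependent.map' R.subtype (Submodule.ker_subtype R)
  have hrank (ν : Set.Iio (0 : ℝ)) :
      Cardinal.toENat (Module.rank ℂ (eigenspace (formOperator h) ((ν : ℝ) : ℂ))) =
        ((Finset.univ.filter fun i => μ i = ν).card : ℕ∞) := by
    rw [hspan ν]
    have h1 : LinearIndependent ℂ fun i : {i // μ i = ν} => (b i : E) :=
      hli.comp _ Subtype.val_injective
    have := FiniteDimensional.span_of_finite ℂ
      (Set.finite_range fun i : {i // μ i = ν} => (b i : E))
    rw [← Module.finrank_eq_rank, finrank_span_eq_card h1, Fintype.card_subtype, map_natCast]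
  unfold negEigenvalueCount
  simp_rw [hrank]
  rw [tsum_eq_sum (s := Finset.univ.image μ)]
  · rw [← Nat.cast_sum, ← Finset.card_eq_sum_card_image, Finset.card_univ, Fintype.card_fin]
  · intro ν hν
    rw [Nat.cast_eq_zero, Finset.card_eq_zero, Finset.filter_eq_empty_iff]
    intro i _ hi
    exact hν (Finset.mem_image.2 ⟨i, Finset.mem_univ _, hi⟩)

end IsNegPart

/-- If the negative index of a semibounded form is finite, it is the number of negative eigenvalues
of the associated operator. -/
theorem IsFormResolvent.negEigenvalueCount_eq [CompleteSpace E] {D : Submodule ℂ E}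
    {h : SesqForm D} {c : ℝ} {B : E →L[ℂ] E} (hB : IsFormResolvent h c B) {n : ℕ}
    (hn : negIndex h = n) : negEigenvalueCount (formOperator h) = n := by
  obtain ⟨P, N, hN⟩ := hB.exists_isNegPart
  have h1 := hN.negIndex_eq
  rw [hn] at h1
  have : FiniteDimensional ℂ (LinearMap.range (N : E →ₗ[ℂ] E)) := by
    rw [FiniteDimensional, ← Module.rank_lt_aleph0_iff]
    exact (Cardinal.toENat_le_natCast.1 h1.symm.le).trans_lt Cardinal.natCast_lt_aleph0
  rw [hN.negEigenvalueCount_eq, h1, ← Module.finrank_eq_rank]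
  simp

end NegativeSpectrum

/-! ### Exponential polynomials -/

section ExponentialPolynomials

/-- The function `t ↦ P(t) e^{-β t}`. -/
def expPoly (β : ℂ) (p : ℂ[X]) (t : ℝ) : ℂ := p.eval (t : ℂ) * Complex.exp (-β * t)

/-- The translation operator `(τ f)(t) = f(t + h)`. -/
def shift (h : ℝ) : Module.End ℂ (ℝ → ℂ) := LinearMap.funLeft ℂ ℂ (· + h)

theorem shift_pow_apply (h : ℝ) (n : ℕ) (f : ℝ → ℂ) (t : ℝ) :
    (shift h ^ n) f t = f (t + n * h) := by
  induction n generalizing t with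
  | zero => simp
  | succ n ih =>
    rw [pow_succ', Module.End.mul_apply]
    change (shift h ^ n) f (t + h) = _
    rw [ih]
    congr 1
    push_cast
    ring

/-- Each function `P(t) e^{-β t}` is a generalized eigenvector of every translation. -/
theorem shift_sub_pow_expPoly (h : ℝ) (β : ℂ) (n : ℕ) (p : ℂ[X]) (hp : p.degree < n) :
    ((shift h - Complex.exp (-β * h) • 1) ^ n) (expPoly β p) = 0 := by
  induction n generalizing p with
  | zero =>
    have : p = 0 := by simpa using hp
    funext t
    simp [this, expPoly]
  | succ n ih =>
    rw [pow_succ, Module.End.mul_apply]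
    set q : ℂ[X] := C (Complex.exp (-β * h)) * (taylor (h : ℂ) p - p) with hq
    have h1 : (shift h - Complex.exp (-β * h) • 1) (expPoly β p) = expPoly β q := by
      funext t
      simp only [LinearMap.sub_apply, LinearMap.smul_apply, Module.End.one_apply, Pi.sub_apply,
        Pi.smul_apply, smul_eq_mul]
      change expPoly β p (t + h) - _ = _
      simp only [expPoly, hq, eval_mul, eval_C, eval_sub, taylor_eval, Complex.ofReal_add, mul_add,
        Complex.exp_add]
      ring
    rw [h1]
    refine ih q ?_
    by_cases hp0 : p = 0
    · simp [hq, hp0]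
    have h2 : (taylor (h : ℂ) p - p).degree < p.degree := by
      have h3 : (taylor (h : ℂ) p).degree = p.degree := degree_taylor p _
      rw [← h3]
      refine degree_sub_lt_left h3
        (fun h0 => hp0 (by rw [← degree_eq_bot, ← h3, h0, degree_zero])) ?_
      rw [leadingCoeff, natDegree_taylor, coeff_taylor_natDegree]
    have h4 : q.degree = (taylor (h : ℂ) p - p).degree := by
      rw [hq, degree_C_mul (Complex.exp_ne_zero _)]
    rw [h4]
    refine h2.trans_le ?_
    rw [degree_eq_natDegree hp0] at hp ⊢
    norm_cast at hp ⊢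
    omega

theorem analyticOnNhd_expPoly (β : ℂ) (p : ℂ[X]) :
    AnalyticOnNhd ℝ (expPoly β p) Set.univ := by
  intro t _
  have h1 : AnalyticAt ℂ (fun z : ℂ => p.eval z * Complex.exp (-β * z)) (t : ℂ) := by
    refine AnalyticAt.mul ?_ ?_
    · exact AnalyticOnNhd.eval_polynomial p _ (Set.mem_univ _)
    · fun_prop
  exact h1.restrictScalars.comp (Complex.ofRealCLM.analyticAt t)

theorem continuous_expPoly (β : ℂ) (p : ℂ[X]) : Continuous (expPoly β p) := by
  unfold expPoly
  fun_prop

theorem eq_zero_of_expPoly_eq_zero {β : ℂ} {p : ℂ[X]} (hp : expPoly β p = 0) : p = 0 := by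
  refine eq_zero_of_infinite_isRoot p ?_
  refine (Set.infinite_range_of_injective Complex.ofReal_injective).mono ?_
  rintro _ ⟨t, rfl⟩
  have := congrFun hp t
  simpa [expPoly, Complex.exp_ne_zero] using this

/-- Linear independence: a finite sum of exponential polynomials with distinct exponents vanishes
on the half-line only if all coefficients vanish. For a small step `h` the numbers `e^{-β h}` are
distinct, so the terms belong to different generalized eigenspaces of the translation by `h`. -/
theorem eq_zero_of_sum_expPoly_eq_zero (s : Finset ℂ) (p : ℂ → ℂ[X])
    (h0 : ∀ t : ℝ, 0 < t → ∑ β ∈ s, expPoly β (p β) t = 0) : ∀ β ∈ s, p β = 0 := by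
  have hall : (∑ β ∈ s, expPoly β (p β)) = 0 := by
    refine AnalyticOnNhd.eq_of_eventuallyEq (𝕜 := ℝ) (z₀ := 1) ?_ analyticOnNhd_const ?_
    · exact Finset.analyticOnNhd_sum s fun β _ => analyticOnNhd_expPoly β (p β)
    · filter_upwards [lt_mem_nhds zero_lt_one] with t ht
      rw [Finset.sum_apply, h0 t ht]
      rfl
  -- with this step all `-β h` lie in the strip `|Im z| < π`, where `exp` is injective
  set h : ℝ := (1 + ∑ β ∈ s, ‖β‖)⁻¹ with hh
  have hS : 0 ≤ ∑ β ∈ s, ‖β‖ := Finset.sum_nonneg fun _ _ => norm_nonneg _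
  have hpos : 0 < h := by positivity
  have him : ∀ β ∈ s, |(-β * h).im| < Real.pi := by
    intro β hβ
    have h1 : ‖β‖ ≤ ∑ β ∈ s, ‖β‖ := 
      Finset.single_le_sum (f := fun β : ℂ => ‖β‖) (fun _ _ => norm_nonneg _) hβ
    calc |(-β * h).im| ≤ ‖-β * h‖ := Complex.abs_im_le_norm _
      _ = ‖β‖ * h := by rw [norm_mul, norm_neg, Complex.norm_real, Real.norm_of_nonneg hpos.le]
      _ ≤ 1 := by
        rw [hh, ← div_eq_mul_inv, div_le_one (by positivity)]
        linarith
      _ < Real.pi := by linarith [Real.pi_gt_three]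
  have hinj : Set.InjOn (fun β : ℂ => Complex.exp (-β * h)) s := by
    intro a ha b hb hab
    have h1 := abs_lt.1 (him a ha)
    have h2 := abs_lt.1 (him b hb)
    have h3 := Complex.exp_inj_of_neg_pi_lt_of_le_pi h1.1 h1.2.le h2.1 h2.2.le hab
    exact neg_injective (mul_right_cancel₀ (by exact_mod_cast hpos.ne') h3)
  have hind := (Module.End.independent_maxGenEigenspace (shift h)).comp
    (f := fun β : s => Complex.exp (-(β : ℂ) * h))
    (fun a b hab => Subtype.ext (hinj a.2 b.2 hab))
  rw [iSupIndep_iff_finsetSum_eq_zero_imp_eq_zero] at hind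
  intro β hβ
  refine eq_zero_of_expPoly_eq_zero (β := β) ?_
  refine hind Finset.univ (fun β => expPoly β (p β)) (fun β _ => ?_) ?_ ⟨β, hβ⟩
    (Finset.mem_univ _)
  · rw [Function.comp_apply, Module.End.mem_maxGenEigenspace]
    refine ⟨(p β).natDegree + 1, shift_sub_pow_expPoly _ _ _ _ ?_⟩
    exact (degree_le_natDegree).trans_lt (by exact_mod_cast Nat.lt_succ_self _)
  · rw [← hall, ← Finset.sum_coe_sort s fun β => expPoly β (p β)]

/-- A finite sum of exponential polynomials satisfies a linear recurrence with constant
coefficients. -/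
theorem exists_recurrence (s : Finset ℂ) (p : ℂ → ℂ[X]) :
    ∃ Q : ℂ[X], Q ≠ 0 ∧ ∀ t : ℝ,
      ∑ i ∈ Finset.range (Q.natDegree + 1), Q.coeff i * ∑ β ∈ s, expPoly β (p β) (t + i) = 0 := by
  suffices h : ∃ Q : ℂ[X], Q ≠ 0 ∧ aeval (shift 1) Q (∑ β ∈ s, expPoly β (p β)) = 0 by
    obtain ⟨Q, hQ, h⟩ := h
    refine ⟨Q, hQ, fun t => ?_⟩
    have h1 := congrFun h t
    rw [aeval_eq_sum_range, LinearMap.sum_apply, Finset.sum_apply] at h1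
    simpa [shift_pow_apply, Finset.sum_apply, Finset.mul_sum] using h1
  classical
  induction s using Finset.induction_on with
  | empty => exact ⟨1, one_ne_zero, by simp⟩
  | insert β s hβ ih =>
    obtain ⟨Q, hQ, h⟩ := ih
    set z := Complex.exp (-β * (1 : ℝ)) with hz
    refine ⟨Q * (X - C z) ^ ((p β).natDegree + 1),
      mul_ne_zero hQ (pow_ne_zero _ (X_sub_C_ne_zero z)), ?_⟩
    have h1 : aeval (shift 1) ((X - C z) ^ ((p β).natDegree + 1)) (expPoly β (p β)) = 0 := by
      have := shift_sub_pow_expPoly 1 β ((p β).natDegree + 1) (p β)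
        (degree_le_natDegree.trans_lt (by exact_mod_cast Nat.lt_succ_self _))
      rw [map_pow, map_sub, aeval_X, aeval_C, Algebra.algebraMap_eq_smul_one]
      exact this
    rw [Finset.sum_insert hβ, map_add]
    nth_rewrite 2 [mul_comm]
    rw [map_mul, map_mul, Module.End.mul_apply, Module.End.mul_apply, h1, h, map_zero, map_zero,
      add_zero]

end ExponentialPolynomials

/-! ### Uniqueness in the moment problem for `e^{-x}` -/

section Moments

/-- An integrable function on `(0, ∞)` is determined by its moments with respect to `e^{-x}`: by the
Weierstrass theorem the moments determine the integrals against all test functions. -/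
theorem ae_eq_zero_of_moments {μ : Measure ℝ} (hμ : ∀ᵐ x ∂μ, 0 < x) {F : ℝ → ℂ}
    (hF : Integrable F μ) (h : ∀ n : ℕ, ∫ x, ((Real.exp (-x) ^ n : ℝ) : ℂ) * F x ∂μ = 0) :
    F =ᵐ[μ] 0 := by
  have hpoly : ∀ p : ℝ[X], ∫ x, ((p.eval (Real.exp (-x)) : ℝ) : ℂ) * F x ∂μ = 0 := by
    intro p
    have hint (n : ℕ) : Integrable (fun x => ((Real.exp (-x) ^ n : ℝ) : ℂ) * F x) μ := by
      refine hF.bdd_mul (c := 1) (by fun_prop) ?_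
      filter_upwards [hμ] with x hx
      rw [Complex.norm_real, Real.norm_of_nonneg (by positivity)]
      exact pow_le_one₀ (by positivity) (Real.exp_le_one_iff.2 (by linarith))
    have he (x : ℝ) : ((p.eval (Real.exp (-x)) : ℝ) : ℂ) * F x =
        ∑ i ∈ Finset.range (p.natDegree + 1),
          (p.coeff i : ℂ) * (((Real.exp (-x) ^ i : ℝ) : ℂ) * F x) := by
      rw [eval_eq_sum_range, Complex.ofReal_sum, Finset.sum_mul]
      refine Finset.sum_congr rfl fun i _ => ?_
      push_cast
      ring
    simp_rw [he]
    rw [integral_finsetSum _ fun i _ => (hint i).const_mul _]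
    refine Finset.sum_eq_zero fun i _ => ?_
    rw [integral_const_mul, h, mul_zero]
  have key := isOpen_Ioi.ae_eq_zero_of_integral_contDiff_smul_eq_zero (U := Set.Ioi (0 : ℝ))
    (hF.locallyIntegrable.locallyIntegrableOn _) (fun g hg hgc hgs => ?_)
  · filter_upwards [hμ, key] with x hx hx'
    exact hx' hx
  -- in the variable `y = e^{-x}` the test function is continuous on `[0, 1]`
  let G : ℝ → ℝ := fun y => g (-Real.log y)
  have hG : Continuous G := by
    rw [continuous_iff_continuousAt]
    intro y
    rcases eq_or_ne y 0 with rfl | hy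
    · obtain ⟨R, hR⟩ := hgc.isCompact.isBounded.subset_closedBall 0
      have hev : ∀ᶠ y in 𝓝 (0 : ℝ), G y = 0 := by
        filter_upwards [Metric.ball_mem_nhds (0 : ℝ) (Real.exp_pos (-R))] with y hy
        by_contra hne
        have h1 : -Real.log y ∈ tsupport g := subset_tsupport g hne
        have h2 : 0 < -Real.log y := hgs h1
        have h3 : |Real.log y| ≤ R := by simpa using hR h1
        have hy0 : y ≠ 0 := by rintro rfl; simp at h2
        have h4 : Real.log |y| < -R := by
          rw [Metric.mem_ball, dist_zero_right, Real.norm_eq_abs] at hy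
          rwa [← Real.log_exp (-R), Real.log_lt_log_iff (abs_pos.2 hy0) (Real.exp_pos _)]
        rw [Real.log_abs] at h4
        have := (abs_le.1 h3).1
        linarith
      exact (continuousAt_const (y := (0 : ℝ))).congr (hev.mono fun y hy => hy.symm)
    · exact hg.continuous.continuousAt.comp (Real.continuousAt_log hy).neg
  have hgG : ∀ x, g x = G (Real.exp (-x)) := fun x => by simp [G]
  have hgint : Integrable (fun x => g x • F x) μ := by
    obtain ⟨C, hC⟩ := hg.continuous.bounded_above_of_compact_support hgc
    refine (hF.bdd_mul (c := C) (f := fun x => (g x : ℂ)) ?_ (ae_of_all _ fun x => ?_)).congr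
      (ae_of_all _ fun x => ?_)
    · exact (Complex.continuous_ofReal.comp hg.continuous).aestronglyMeasurable
    · rw [Complex.norm_real]; exact hC x
    · simp
  refine norm_eq_zero.1 (le_antisymm (le_of_forall_pos_le_add fun ε hε => ?_) (norm_nonneg _))
  set S := ∫ x, ‖F x‖ ∂μ with hS
  have hS0 : 0 ≤ S := integral_nonneg fun _ => norm_nonneg _
  obtain ⟨p, hp⟩ := exists_polynomial_near_of_continuousOn 0 1 G hG.continuousOn (ε / (S + 1))
    (by positivity)
  have hpint : Integrable (fun x => ((p.eval (Real.exp (-x)) : ℝ) : ℂ) * F x) μ := by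
    obtain ⟨C, hC⟩ := isCompact_Icc.exists_bound_of_continuousOn (s := Set.Icc (0 : ℝ) 1)
      (f := fun y => p.eval y) p.continuous.continuousOn
    refine hF.bdd_mul (c := C) ?_ ?_
    · exact (Complex.continuous_ofReal.comp
        (p.continuous.comp (by fun_prop))).aestronglyMeasurable
    · filter_upwards [hμ] with x hx
      rw [Complex.norm_real]
      exact hC _ ⟨by positivity, Real.exp_le_one_iff.2 (by linarith)⟩
  calc ‖∫ x, g x • F x ∂μ‖ = ‖∫ x, (g x • F x - ((p.eval (Real.exp (-x)) : ℝ) : ℂ) * F x) ∂μ‖ := by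
        rw [integral_sub hgint hpint, hpoly, sub_zero]
    _ ≤ ∫ x, ε / (S + 1) * ‖F x‖ ∂μ := by
        refine norm_integral_le_of_norm_le (hF.norm.const_mul _) ?_
        filter_upwards [hμ] with x hx
        have h1 := hp (Real.exp (-x)) ⟨by positivity, Real.exp_le_one_iff.2 (by linarith)⟩
        rw [Complex.real_smul, ← sub_mul, norm_mul, ← Complex.ofReal_sub, Complex.norm_real,
          Real.norm_eq_abs, hgG, abs_sub_comm]
        gcongr
    _ = ε / (S + 1) * S := by rw [integral_const_mul]
    _ ≤ 0 + ε := by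
        rw [zero_add, div_mul_eq_mul_div, div_le_iff₀ (by positivity)]
        nlinarith

end Moments

/-! ### The measure `σ₀(x) dx` -/

section Sigma

/-- The growth conditions on `σ₀`, combined in one bound on the whole half-line. -/
theorem IsAdmissibleSigma.exists_bound {σ₀ : ℝ → ℝ} (hσ : IsAdmissibleSigma σ₀) :
    ∃ r s C : ℝ, -1 < r ∧ -1 < s ∧
      ∀ᵐ x ∂halfLine, |σ₀ x| ≤ C * (x ^ r + x ^ (0 : ℝ) + x ^ s) := by
  obtain ⟨lp, hlp, h0⟩ := hσ.isBigO_zero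
  obtain ⟨lm, h1⟩ := hσ.isBigO_infty
  obtain ⟨C0, hC0, h0⟩ := h0.exists_pos
  obtain ⟨C1, hC1, h1⟩ := h1.exists_pos
  rw [Asymptotics.IsBigOWith, Filter.eventually_inf] at h0 h1
  obtain ⟨s0, hs0, t0, ht0, h0⟩ := h0
  obtain ⟨s1, hs1, t1, ht1, h1⟩ := h1
  obtain ⟨δ, hδ, hs0⟩ := mem_nhdsGT_iff_exists_Ioo_subset.1 hs0
  obtain ⟨R, hR⟩ := mem_atTop_sets.1 hs1
  obtain ⟨C2, h2⟩ := hσ.locally_bounded δ (max R 1) hδ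
  have hδ' : 0 < δ := hδ
  refine ⟨-lp, max lm 0, C0 + C1 + |C2|, by linarith, lt_max_of_lt_right (by norm_num), ?_⟩
  filter_upwards [h2, ae_restrict_mem measurableSet_Ioi, ae_restrict_of_ae ht0,
    ae_restrict_of_ae ht1] with x hx2 hx hx0 hx1
  have hx : 0 < x := hx
  have p1 : 0 ≤ x ^ (-lp) := Real.rpow_nonneg hx.le _
  have p2 : 0 ≤ x ^ (max lm 0) := Real.rpow_nonneg hx.le _
  rw [Real.rpow_zero]
  rcases lt_or_ge x δ with hxδ | hxδ
  · have := h0 x ⟨hs0 ⟨hx, hxδ⟩, hx0⟩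
    rw [Real.norm_eq_abs, Real.norm_of_nonneg p1] at this
    nlinarith [abs_nonneg C2]
  rcases le_or_gt x (max R 1) with hxR | hxR
  · have := (hx2 ⟨hxδ, hxR⟩).trans (le_abs_self C2)
    nlinarith [abs_nonneg C2]
  · have := h1 x ⟨hR x ((le_max_left _ _).trans hxR.le), hx1⟩
    rw [Real.norm_eq_abs, Real.norm_of_nonneg (Real.rpow_nonneg hx.le _)] at this
    have h3 : x ^ lm ≤ x ^ (max lm 0) :=
      Real.rpow_le_rpow_of_exponent_le ((le_max_right R 1).trans hxR.le) (le_max_left _ _)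
    nlinarith [abs_nonneg C2]

theorem IsAdmissibleSigma.integrable_exp {σ₀ : ℝ → ℝ} (hσ : IsAdmissibleSigma σ₀) {a : ℝ}
    (ha : 0 < a) : Integrable (fun x => Real.exp (-(a * x))) (sigmaMeasure σ₀) := by
  obtain ⟨r, s, C, hr, hs, hb⟩ := hσ.exists_bound
  have hm : AEMeasurable (fun x => ENNReal.ofReal (σ₀ x)) halfLine :=
    hσ.aemeasurable.ennreal_ofReal
  rw [sigmaMeasure, integrable_withDensity_iff_integrable_smul₀' hm
    (ae_of_all _ fun _ => ENNReal.ofReal_lt_top)]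
  have hI {q : ℝ} (hq : -1 < q) : Integrable (fun x => x ^ q * Real.exp (-(a * x))) halfLine := by
    have := integrableOn_rpow_mul_exp_neg_mul_rpow hq one_pos ha
    simpa [IntegrableOn] using this
  refine (((hI hr).add (hI (by norm_num : (-1 : ℝ) < 0))).add (hI hs)).const_mul C |>.mono' ?_ ?_
  · exact (hm.ennreal_toReal.smul (by fun_prop)).aestronglyMeasurable
  · filter_upwards [hb] with x hx
    rw [norm_smul, Real.norm_of_nonneg ENNReal.toReal_nonneg, Real.norm_of_nonneg (by positivity),
      ENNReal.toReal_ofReal']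
    have h1 : max (σ₀ x) 0 ≤ |σ₀ x| := max_le (le_abs_self _) (abs_nonneg _)
    calc max (σ₀ x) 0 * Real.exp (-(a * x)) ≤
          (C * (x ^ r + x ^ (0 : ℝ) + x ^ s)) * Real.exp (-(a * x)) := by
          gcongr; exact h1.trans hx
      _ = _ := by simp only [Pi.add_apply]; ring

end Sigma

/-! ### The Laplace transform as a closed operator -/

section Pairing

theorem memLp_star {μ : Measure ℝ} {e : ℝ → ℂ} (he : MemLp e 2 μ) :
    MemLp (fun t => conj (e t)) 2 μ := he.star

/-- The bilinear pairing `∫ e f` of square integrable functions is an inner product. -/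
theorem integral_mul_eq_inner {μ : Measure ℝ} {e : ℝ → ℂ} (he : MemLp e 2 μ) (f : Lp ℂ 2 μ) :
    ∫ t, e t * f t ∂μ = inner ℂ ((memLp_star he).toLp _) f := by
  rw [L2.inner_def]
  refine integral_congr_ae ?_
  filter_upwards [(memLp_star he).coeFn_toLp] with t ht
  rw [ht, RCLike.inner_apply, Complex.conj_conj, mul_comm]

theorem memLp_exp {x : ℝ} (hx : 0 < x) :
    MemLp (fun t : ℝ => (Real.exp (-(t * x)) : ℂ)) 2 halfLine := by
  rw [memLp_two_iff_integrable_sq_norm (by fun_prop)]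
  have h2 : IntegrableOn (fun t : ℝ => Real.exp (-(2 * x) * t)) (Set.Ioi 0) :=
    exp_neg_integrableOn_Ioi 0 (by positivity)
  refine h2.congr (ae_of_all _ fun t => ?_)
  simp only [Complex.norm_real, Real.norm_eq_abs, Real.abs_exp, ← Real.exp_nat_mul]
  congr 1
  push_cast
  ring

theorem tendsto_laplace {f : L2} {u : ℕ → L2} (hu : Tendsto u atTop (𝓝 f)) {x : ℝ} (hx : 0 < x) :
    Tendsto (fun n => laplace (u n) x) atTop (𝓝 (laplace f x)) := by
  simp only [laplace, integral_mul_eq_inner (memLp_exp hx)]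
  exact (continuous_const.inner continuous_id).continuousAt.tendsto.comp hu

/-- The Laplace transform is closed since `f ↦ (L f)(x)` is continuous on `L²(0, ∞)` for
each `x > 0`. -/
theorem isClosed_laplaceOperator (σ₀ : ℝ → ℝ) : (laplaceOperator σ₀).IsClosed := by
  refine IsSeqClosed.isClosed ?_
  intro u p hu hup
  choose f hf1 hf2 using fun n => (LinearPMap.mem_graph_iff _).1 (hu n)
  have h1 : Tendsto (fun n => ((f n : laplaceDomain σ₀) : L2)) atTop (𝓝 p.1) := by
    simp_rw [hf1]
    exact (continuous_fst.tendsto p).comp hup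
  have h2 : Tendsto (fun n => laplaceOperator σ₀ (f n)) atTop (𝓝 p.2) := by
    simp_rw [hf2]
    exact (continuous_snd.tendsto p).comp hup
  obtain ⟨ns, hns, hae⟩ := (tendstoInMeasure_of_tendsto_Lp h2).exists_seq_tendsto_ae
  have hall : ∀ᵐ x ∂sigmaMeasure σ₀, ∀ n,
      (laplaceOperator σ₀ (f n) : ℝ → ℂ) x = laplace ((f n : laplaceDomain σ₀) : L2) x :=
    ae_all_iff.2 fun n => MemLp.coeFn_toLp (f n).2
  have heq : (p.2 : ℝ → ℂ) =ᵐ[sigmaMeasure σ₀] laplace p.1 := by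
    filter_upwards [hae, hall, ae_pos_sigmaMeasure σ₀] with x hx hx' hx0
    refine tendsto_nhds_unique hx ?_
    simp_rw [hx']
    exact (tendsto_laplace h1 hx0).comp hns.tendsto_atTop
  have hmem : p.1 ∈ laplaceDomain σ₀ := (memLp_congr_ae heq).1 (Lp.memLp p.2)
  refine (LinearPMap.mem_graph_iff _).2 ⟨⟨p.1, hmem⟩, rfl, ?_⟩
  refine Lp.ext ?_
  exact (MemLp.coeFn_toLp (f := laplace p.1) hmem).trans heq.symm

theorem aestronglyMeasurable_laplace (f : L2) (μ : Measure ℝ) :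
    AEStronglyMeasurable (laplace f) μ := by
  have h1 : StronglyMeasurable fun p : ℝ × ℝ => (Real.exp (-(p.2 * p.1)) : ℂ) * f p.2 := by
    refine StronglyMeasurable.mul ?_ ((Lp.stronglyMeasurable f).comp_measurable measurable_snd)
    exact Continuous.stronglyMeasurable (by fun_prop)
  exact (h1.integral_prod_right (ν := halfLine)).aestronglyMeasurable

/-- Square integrable functions supported in a compact subset of `(0, ∞)` belong to the form
domain, as their Laplace transforms are bounded and decay exponentially. -/
theorem mem_laplaceDomain {σ₀ : ℝ → ℝ} (hσ : IsAdmissibleSigma σ₀) {a b : ℝ} (ha : 0 < a)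
    {u : ℝ → ℂ} (hu : MemLp u 2 halfLine) (hs : ∀ t, t ∉ Set.Icc a b → u t = 0) :
    hu.toLp u ∈ laplaceDomain σ₀ := by
  have hint : Integrable u halfLine := by
    have h1 : MemLp ((Set.Icc a b).indicator fun _ => (1 : ℂ)) 2 halfLine := by
      refine memLp_indicator_const 2 measurableSet_Icc 1 (Or.inr ?_)
      exact ((Measure.restrict_apply_le _ _).trans_lt measure_Icc_lt_top).ne
    refine (h1.integrable_mul hu).congr (ae_of_all _ fun t => ?_)
    by_cases ht : t ∈ Set.Icc a b
    · simp [ht]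
    · simp [ht, hs t ht]
  change MemLp (laplace (hu.toLp u)) 2 (sigmaMeasure σ₀)
  have hexp : MemLp (fun x => Real.exp (-(a * x))) 2 (sigmaMeasure σ₀) := by
    rw [memLp_two_iff_integrable_sq (by fun_prop)]
    refine (hσ.integrable_exp (a := 2 * a) (by positivity)).congr (ae_of_all _ fun x => ?_)
    simp only [← Real.exp_nat_mul]
    congr 1
    push_cast
    ring
  refine hexp.of_le_mul (c := ∫ t, ‖u t‖ ∂halfLine) (aestronglyMeasurable_laplace _ _) ?_
  filter_upwards [ae_pos_sigmaMeasure σ₀] with x hx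
  rw [Real.norm_of_nonneg (by positivity), mul_comm, ← integral_const_mul]
  refine norm_integral_le_of_norm_le (hint.norm.const_mul _) ?_
  filter_upwards [hu.coeFn_toLp] with t ht
  rw [ht, norm_mul, Complex.norm_real, Real.norm_of_nonneg (by positivity)]
  by_cases hta : t ∈ Set.Icc a b
  · gcongr
    exact hta.1
  · simp [hs t hta]

theorem dense_laplaceDomain {σ₀ : ℝ → ℝ} (hσ : IsAdmissibleSigma σ₀) :
    Dense (laplaceDomain σ₀ : Set L2) := by
  rw [Submodule.dense_iff_topologicalClosure_eq_top, Submodule.topologicalClosure_eq_top_iff,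
    Submodule.eq_bot_iff]
  intro g hg
  have hloc (n : ℕ) : ∀ᵐ t ∂halfLine, t ∈ Set.Icc ((n : ℝ) + 1)⁻¹ (n : ℝ) → g t = 0 := by
    set I := Set.Icc ((n : ℝ) + 1)⁻¹ (n : ℝ)
    have hu : MemLp (I.indicator g) 2 halfLine := (Lp.memLp g).indicator measurableSet_Icc
    have h1 := (Submodule.mem_orthogonal _ _).1 hg _
      (mem_laplaceDomain hσ (by positivity) hu fun t ht => Set.indicator_of_notMem ht _)
    have h2 : inner ℂ (hu.toLp _) (hu.toLp _) = (0 : ℂ) := by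
      rw [← h1, L2.inner_def, L2.inner_def]
      refine integral_congr_ae ?_
      filter_upwards [hu.coeFn_toLp] with t ht
      rw [ht]
      by_cases hI : t ∈ I <;> simp [hI]
    have h3 : (I.indicator g : ℝ → ℂ) =ᵐ[halfLine] 0 := by
      have := hu.coeFn_toLp
      rw [inner_self_eq_zero.1 h2] at this
      exact this.symm.trans (Lp.coeFn_zero ℂ 2 halfLine)
    filter_upwards [h3] with t ht hI
    rwa [Set.indicator_of_mem hI] at ht
  refine Lp.ext ?_
  filter_upwards [ae_all_iff.2 hloc, ae_restrict_mem measurableSet_Ioi,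
    Lp.coeFn_zero ℂ 2 halfLine] with t ht ht0 hz
  have ht0 : 0 < t := ht0
  rw [hz]
  obtain ⟨n, hn⟩ := exists_nat_ge (max t t⁻¹)
  refine ht n ⟨?_, (le_max_left _ _).trans hn⟩
  rw [inv_le_comm₀ (by positivity) ht0]
  linarith [(le_max_right t t⁻¹).trans hn]

end Pairing

/-! ### Functionals that are not bounded by the unperturbed form -/

section Independence

theorem coe_laplaceOperator {σ₀ : ℝ → ℝ} (f : laplaceDomain σ₀) :
    ((laplaceOperator σ₀).toFun f : ℝ → ℂ) =ᵐ[sigmaMeasure σ₀] laplace (f : L2) :=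
  MemLp.coeFn_toLp f.2

/-- An exponential polynomial `q` for which the functional `f ↦ ∫ q f` is bounded by the norm of
`L f` in `L²(σ₀ dx)` vanishes. Indeed, testing on the translates by `n` of `f` multiplies
the density `F = (L f) conj w` by `e^{-n x}` and shifts `q`. Since `q` satisfies a recurrence, all
moments of `Q(e^{-x}) F` vanish for some polynomial `Q ≠ 0`, hence `F = 0` as the measure
`σ₀ dx` has no atoms. -/
theorem expPoly_sum_eq_zero_of_bounded {σ₀ : ℝ → ℝ} (hσ : IsAdmissibleSigma σ₀)
    (w : Lp ℂ 2 (sigmaMeasure σ₀)) (s : Finset ℂ) (p : ℂ → ℂ[X])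
    (hw : ∀ f : laplaceDomain σ₀, inner ℂ w ((laplaceOperator σ₀).toFun f) =
      ∫ t, (∑ β ∈ s, expPoly β (p β) t) * (f : L2) t ∂halfLine) :
    ∀ t : ℝ, 0 < t → ∑ β ∈ s, expPoly β (p β) t = 0 := by
  intro t₀ ht₀
  set q : ℝ → ℂ := fun t => ∑ β ∈ s, expPoly β (p β) t with hq
  have hqc : Continuous q := continuous_finsetSum _ fun β _ => continuous_expPoly β (p β)
  set a := t₀ / 2 with ha
  set b := 2 * t₀ with hb
  have ha0 : 0 < a := by positivity
  set I := Set.Icc a b with hI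
  let u : ℕ → ℝ → ℂ := fun n t => I.indicator (fun t => conj (q t)) (t - n)
  have hu0 (n : ℕ) (t : ℝ) (ht : t ∉ Set.Icc (a + n) (b + n)) : u n t = 0 := by
    refine Set.indicator_of_notMem (fun h => ht ?_) _
    exact ⟨by linarith [h.1], by linarith [h.2]⟩
  have hpos (n : ℕ) : 0 < a + n := by positivity
  have huI (n : ℕ) (t : ℝ) (ht : t ∉ Set.Ioi (0 : ℝ)) : u n t = 0 :=
    hu0 n t fun h => ht ((hpos n).trans_le h.1)
  have hu (n : ℕ) : MemLp (u n) 2 halfLine := by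
    have h1 : MemLp (I.indicator fun t => conj (q t)) 2 volume := by
      rw [memLp_indicator_iff_restrict measurableSet_Icc]
      have hc : Continuous fun t => conj (q t) := Complex.continuous_conj.comp hqc
      obtain ⟨C, hC⟩ := isCompact_Icc.exists_bound_of_continuousOn (s := I) hc.continuousOn
      have : IsFiniteMeasure (volume.restrict I) :=
        ⟨by rw [Measure.restrict_apply_univ]; exact measure_Icc_lt_top⟩
      exact MemLp.of_bound hc.aestronglyMeasurable C
        ((ae_restrict_mem measurableSet_Icc).mono hC)
    exact (h1.comp_measurePreserving (measurePreserving_sub_right volume (n : ℝ))).restrict _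
  let f : ℕ → laplaceDomain σ₀ := fun n =>
    ⟨(hu n).toLp _, mem_laplaceDomain hσ (hpos n) (hu n) (hu0 n)⟩
  -- a translation of the support acts on pairings by the opposite translation
  have hpair (e : ℝ → ℂ) (n : ℕ) : ∫ t, e t * (f n : L2) t ∂halfLine =
      ∫ t, e (t + n) * u 0 t := by
    have h1 : ∫ t, e t * (f n : L2) t ∂halfLine = ∫ t, e t * u n t ∂halfLine :=
      integral_congr_ae ((hu n).coeFn_toLp.mono fun t ht => congrArg (e t * ·) ht)
    rw [h1, setIntegral_eq_integral_of_forall_compl_eq_zero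
      fun t ht => by rw [huI n t ht, mul_zero],
      ← integral_add_right_eq_self (fun t => e t * u n t) (n : ℝ)]
    simp [u]
  have hlap (n : ℕ) (x : ℝ) : laplace (f n : L2) x =
      ((Real.exp (-x) ^ n : ℝ) : ℂ) * laplace (f 0 : L2) x := by
    rw [laplace, laplace, hpair, hpair, ← integral_const_mul]
    refine integral_congr_ae (ae_of_all _ fun t => ?_)
    simp only [← Real.exp_nat_mul, Nat.cast_zero, add_zero]
    rw [← mul_assoc, ← Complex.ofReal_mul, ← Real.exp_add]
    congr 4
    ring
  set F : ℝ → ℂ := fun x => conj (w x) * laplace (f 0 : L2) x with hF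
  have hFint : Integrable F (sigmaMeasure σ₀) :=
    (memLp_star (Lp.memLp w)).integrable_mul (f 0).2
  have hmom (n : ℕ) : ∫ x, ((Real.exp (-x) ^ n : ℝ) : ℂ) * F x ∂sigmaMeasure σ₀ =
      ∫ t, q (t + n) * u 0 t := by
    rw [← hpair q n, ← hw (f n), L2.inner_def]
    refine integral_congr_ae ?_
    filter_upwards [coe_laplaceOperator (f n)] with x hx
    rw [hx, hlap, RCLike.inner_apply, hF]
    ring
  obtain ⟨Q, hQ, hrec⟩ := exists_recurrence s p
  have hbd (i : ℕ) :
      Integrable (fun x => ((Real.exp (-x) ^ i : ℝ) : ℂ) * F x) (sigmaMeasure σ₀) := by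
    refine hFint.bdd_mul (c := 1) (by fun_prop) ?_
    filter_upwards [ae_pos_sigmaMeasure σ₀] with x hx
    rw [Complex.norm_real, Real.norm_of_nonneg (by positivity)]
    exact pow_le_one₀ (by positivity) (Real.exp_le_one_iff.2 (by linarith))
  have hqu (n : ℕ) : Integrable (fun t => q (t + n) * u 0 t) := by
    have hc : Continuous fun t => q (t + n) * conj (q t) :=
      (hqc.comp (by fun_prop)).mul (Complex.continuous_conj.comp hqc)
    have h1 : Integrable (I.indicator fun t => q (t + n) * conj (q t)) :=
      (hc.continuousOn.integrableOn_compact isCompact_Icc).integrable_indicator measurableSet_Icc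
    refine h1.congr (ae_of_all _ fun t => ?_)
    by_cases ht : t ∈ I <;> simp [u, ht]
  have hQsum (x : ℝ) : Q.eval ((Real.exp (-x) : ℝ) : ℂ) * F x =
      ∑ i ∈ Finset.range (Q.natDegree + 1),
        Q.coeff i * (((Real.exp (-x) ^ i : ℝ) : ℂ) * F x) := by
    rw [eval_eq_sum_range, Finset.sum_mul]
    refine Finset.sum_congr rfl fun i _ => ?_
    push_cast
    ring
  have hQF : (fun x => Q.eval ((Real.exp (-x) : ℝ) : ℂ) * F x) =ᵐ[sigmaMeasure σ₀] 0 := by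
    refine ae_eq_zero_of_moments (ae_pos_sigmaMeasure σ₀) ?_ fun n => ?_
    · simp_rw [hQsum]
      exact integrable_finsetSum _ fun i _ => (hbd i).const_mul _
    · have h1 (x : ℝ) : ((Real.exp (-x) ^ n : ℝ) : ℂ) * (Q.eval ((Real.exp (-x) : ℝ) : ℂ) * F x) =
          ∑ i ∈ Finset.range (Q.natDegree + 1),
            Q.coeff i * (((Real.exp (-x) ^ (n + i) : ℝ) : ℂ) * F x) := by
        rw [hQsum, Finset.mul_sum]
        refine Finset.sum_congr rfl fun i _ => ?_
        push_cast
        ring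
      simp_rw [h1]
      rw [integral_finsetSum _ fun i _ => (hbd _).const_mul _]
      simp_rw [integral_const_mul, hmom, ← integral_const_mul]
      rw [← integral_finsetSum _ fun i _ => (hqu _).const_mul _]
      refine integral_eq_zero_of_ae (ae_of_all _ fun t => ?_)
      have h2 := hrec (t + n)
      have h3 : ∑ i ∈ Finset.range (Q.natDegree + 1), Q.coeff i * (q (t + (n + i : ℕ)) * u 0 t) =
          (∑ i ∈ Finset.range (Q.natDegree + 1), Q.coeff i * q (t + n + i)) * u 0 t := by
        rw [Finset.sum_mul]
        refine Finset.sum_congr rfl fun i _ => ?_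
        push_cast
        rw [add_assoc, mul_assoc]
      refine h3.trans ?_
      rw [h2, zero_mul]
      rfl
  have hF0 : F =ᵐ[sigmaMeasure σ₀] 0 := by
    have hfin : {x : ℝ | Q.eval ((Real.exp (-x) : ℝ) : ℂ) = 0}.Finite := by
      have h1 := Q.rootSet_finite ℂ
      have hinj : Function.Injective fun x : ℝ => ((Real.exp (-x) : ℝ) : ℂ) := fun x y hxy =>
        neg_injective (Real.exp_injective (Complex.ofReal_injective hxy))
      refine (h1.preimage hinj.injOn).subset fun x hx => ?_
      rw [Set.mem_preimage, mem_rootSet]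
      exact ⟨hQ, by simpa using hx⟩
    have hnull : ∀ᵐ x ∂sigmaMeasure σ₀, Q.eval ((Real.exp (-x) : ℝ) : ℂ) ≠ 0 := by
      have h1 : ∀ᵐ x ∂halfLine, Q.eval ((Real.exp (-x) : ℝ) : ℂ) ≠ 0 :=
        ae_restrict_of_ae (by
          rw [ae_iff]
          simpa using hfin.measure_zero volume)
      exact (withDensity_absolutelyContinuous _ _).ae_le h1
    filter_upwards [hQF, hnull] with x hx hx'
    exact (mul_eq_zero.1 hx).resolve_left hx'
  have hzero : ∫ t in I, ‖q t‖ ^ 2 = 0 := by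
    have h1 := hmom 0
    have h2 : ∫ x, ((Real.exp (-x) ^ 0 : ℝ) : ℂ) * F x ∂sigmaMeasure σ₀ = 0 := by
      refine integral_eq_zero_of_ae (hF0.mono fun x hx => ?_)
      simp only [hx, Pi.zero_apply, mul_zero]
    rw [h2] at h1
    have h3 : (fun t => q (t + (0 : ℕ)) * u 0 t) =
        I.indicator fun t => ((‖q t‖ ^ 2 : ℝ) : ℂ) := by
      funext t
      by_cases ht : t ∈ I
      · simp [u, ht, Complex.mul_conj, Complex.normSq_eq_norm_sq]
      · simp [u, ht]
    rw [h3, integral_indicator measurableSet_Icc, integral_complex_ofReal] at h1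
    exact_mod_cast h1.symm
  have hae : q =ᵐ[volume.restrict I] fun _ => 0 := by
    have hint : IntegrableOn (fun t => ‖q t‖ ^ 2) I :=
      (hqc.norm.pow 2).continuousOn.integrableOn_compact isCompact_Icc
    rw [setIntegral_eq_zero_iff_of_nonneg_ae (ae_of_all _ fun t => by positivity) hint] at hzero
    filter_upwards [hzero] with t ht
    simpa using ht
  exact Measure.eqOn_Icc_of_ae_eq volume (by linarith : a < b).ne hae hqc.continuousOn
    continuousOn_const ⟨by linarith, by linarith⟩

end Independence

/-! ### The matrix of the finite rank form -/

section Coefficients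

variable {M : ℕ}

/-- The polynomial coefficient of `e^{-b t}` in the sum of the terms `Pₘ(t) e^{-βₘ t}`. -/
def expCoeff (β : Fin M → ℂ) (P : Fin M → ℂ[X]) (b : ℂ) : ℂ[X] :=
  ∑ m, if β m = b then P m else 0

theorem expCoeff_apply {β : Fin M → ℂ} (hβ : Function.Injective β) (P : Fin M → ℂ[X])
    (m : Fin M) : expCoeff β P (β m) = P m := by
  simp [expCoeff, hβ.eq_iff]

theorem exists_of_expCoeff_ne_zero {β : Fin M → ℂ} {P : Fin M → ℂ[X]} {b : ℂ}
    (h : expCoeff β P b ≠ 0) : ∃ m, β m = b := by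
  obtain ⟨m, -, hm⟩ := Finset.exists_ne_zero_of_sum_ne_zero h
  exact ⟨m, by by_contra h0; simp [h0] at hm⟩

theorem sum_expCoeff (β : Fin M → ℂ) (P : Fin M → ℂ[X]) (s : Finset ℂ) (hs : ∀ m, β m ∈ s)
    (t : ℝ) : ∑ b ∈ s, expPoly b (expCoeff β P b) t = ∑ m, expPoly (β m) (P m) t := by
  have h1 (b : ℂ) : expPoly b (expCoeff β P b) t =
      ∑ m, if β m = b then expPoly (β m) (P m) t else 0 := by
    rw [expPoly, expCoeff, eval_finsetSum, Finset.sum_mul]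
    refine Finset.sum_congr rfl fun m _ => ?_
    by_cases h : β m = b
    · simp [h, expPoly]
    · simp [h]
  simp_rw [h1]
  rw [Finset.sum_comm]
  refine Finset.sum_congr rfl fun m _ => ?_
  rw [Finset.sum_ite_eq, if_pos (hs m)]

/-- The terms of a real kernel come in complex conjugate pairs. -/
structure IsConjPairing (β : Fin M → ℂ) (P : Fin M → ℂ[X]) (σ : Fin M → Fin M) : Prop where
  exponent : ∀ m, β (σ m) = conj (β m)
  polynomial : ∀ m, P (σ m) = (P m).map (starRingEnd ℂ)

theorem conj_expPoly (b : ℂ) (p : ℂ[X]) (t : ℝ) :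
    conj (expPoly b p t) = expPoly (conj b) (p.map (starRingEnd ℂ)) t := by
  rw [expPoly, expPoly, map_mul, ← Complex.exp_conj, map_mul, map_neg, Complex.conj_ofReal]
  congr 1
  have := eval_map_apply (p := p) (f := starRingEnd ℂ) (t : ℂ)
  rw [Complex.conj_ofReal] at this
  exact this.symm

theorem exists_isConjPairing {β : Fin M → ℂ} {P : Fin M → ℂ[X]} (hβ : Function.Injective β)
    (hP : ∀ m, P m ≠ 0)
    (hv : ∀ t : ℝ, 0 < t → conj (expPolyKernel β P t) = expPolyKernel β P t) :
    ∃ σ, IsConjPairing β P σ := by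
  classical
  set β' : Fin M → ℂ := fun m => conj (β m) with hβ'
  set P' : Fin M → ℂ[X] := fun m => (P m).map (starRingEnd ℂ) with hP'
  have hinj' : Function.Injective β' := (starRingEnd ℂ).injective.comp hβ
  let s : Finset ℂ := Finset.univ.image β ∪ Finset.univ.image β'
  have hs (m) : β m ∈ s :=
    Finset.mem_union_left _ (Finset.mem_image_of_mem _ (Finset.mem_univ _))
  have hs' (m) : β' m ∈ s :=
    Finset.mem_union_right _ (Finset.mem_image_of_mem _ (Finset.mem_univ _))
  have key := eq_zero_of_sum_expPoly_eq_zero s (fun b => expCoeff β P b - expCoeff β' P' b) (by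
    intro t ht
    have h1 (b : ℂ) : expPoly b (expCoeff β P b - expCoeff β' P' b) t =
        expPoly b (expCoeff β P b) t - expPoly b (expCoeff β' P' b) t := by
      simp only [expPoly, eval_sub, sub_mul]
    simp_rw [h1]
    rw [Finset.sum_sub_distrib, sum_expCoeff β P s hs, sum_expCoeff β' P' s hs']
    have h2 := hv t ht
    have h3 : expPolyKernel β P t = ∑ m, expPoly (β m) (P m) t := rfl
    rw [h3, map_sum] at h2
    rw [sub_eq_zero, ← h2]
    exact Finset.sum_congr rfl fun m _ => conj_expPoly _ _ _)
  have hmap (m) : P' m ≠ 0 := (Polynomial.map_ne_zero_iff (starRingEnd ℂ).injective).2 (hP m)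
  have hex (m) : ∃ m', β m' = β' m ∧ P m' = P' m := by
    have h1 := sub_eq_zero.1 (key _ (hs' m))
    rw [expCoeff_apply hinj'] at h1
    obtain ⟨m', hm'⟩ := exists_of_expCoeff_ne_zero (h1.trans_ne (hmap m))
    rw [← hm', expCoeff_apply hβ] at h1
    exact ⟨m', hm', h1⟩
  choose σ h1 h2 using hex
  exact ⟨σ, h1, h2⟩

namespace IsConjPairing

variable {β : Fin M → ℂ} {P : Fin M → ℂ[X]} {σ : Fin M → Fin M}

theorem involutive (hσ : IsConjPairing β P σ) (hβ : Function.Injective β) :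
    Function.Involutive σ := fun m => hβ <| by
  rw [hσ.exponent, hσ.exponent, Complex.conj_conj]

theorem natDegree_eq (hσ : IsConjPairing β P σ) (m : Fin M) :
    (P (σ m)).natDegree = (P m).natDegree := by
  rw [hσ.polynomial, natDegree_map_eq_of_injective (starRingEnd ℂ).injective]

theorem coeff_eq (hσ : IsConjPairing β P σ) (m : Fin M) (n : ℕ) :
    (P (σ m)).coeff n = conj ((P m).coeff n) := by
  rw [hσ.polynomial, coeff_map]

theorem apply_eq_self (hσ : IsConjPairing β P σ) (hβ : Function.Injective β) {m : Fin M}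
    (hm : (β m).im = 0) : σ m = m :=
  hβ ((hσ.exponent m).trans (Complex.conj_eq_iff_im.2 hm))

theorem im_eq (hσ : IsConjPairing β P σ) (m : Fin M) : (β (σ m)).im = -(β m).im := by
  rw [hσ.exponent, Complex.conj_im]

end IsConjPairing

/-- The pairs `(m, k)` with `k ≤ Kₘ`, which index the functions `t ^ k e^{-βₘ t}`. -/
abbrev TermIndex (P : Fin M → ℂ[X]) : Type := Σ m : Fin M, Fin ((P m).natDegree + 1)

/-- The Hermitian matrix of the form `(V f, f)` in the coordinates `∫₀^∞ t ^ k e^{-βₘ t} f(t) dt`.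
The block of a term is located at the position of that term and its conjugate, and
contains the coefficients of `Pₘ(t + s)` at `t ^ j s ^ k`. -/
def kernelMatrix (P : Fin M → ℂ[X]) (σ : Fin M → Fin M) :
    Matrix (TermIndex P) (TermIndex P) ℂ := fun i i' =>
  if i'.1 = σ i.1 then
    (P i'.1).coeff (i.2 + i'.2) * ((i.2 + i'.2 : ℕ).choose i.2 : ℂ)
  else 0

theorem eval_add_eq_sum (p : ℂ[X]) {n : ℕ} (hn : p.natDegree < n) (x y : ℂ) :
    p.eval (x + y) = ∑ j ∈ Finset.range n, ∑ k ∈ Finset.range n,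
      p.coeff (j + k) * ((j + k).choose j : ℂ) * x ^ j * y ^ k := by
  rw [← taylor_eval, eval_eq_sum_range' (n := n) (by rwa [natDegree_taylor])]
  refine Finset.sum_congr rfl fun j _ => ?_
  rw [taylor_coeff, eval_eq_sum_range' (n := n)
    (((natDegree_hasseDeriv_le p j).trans (Nat.sub_le _ _)).trans_lt hn), Finset.sum_mul]
  refine Finset.sum_congr rfl fun k _ => ?_
  rw [hasseDeriv_coeff, add_comm k j]
  ring

theorem expPolyKernel_add {β : Fin M → ℂ} {P : Fin M → ℂ[X]} {σ : Fin M → Fin M}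
    (hβ : Function.Injective β) (hσ : IsConjPairing β P σ) (t s : ℝ) :
    expPolyKernel β P (t + s) = ∑ i : TermIndex P, ∑ i' : TermIndex P, kernelMatrix P σ i i' *
      (conj (expPoly (β i.1) (X ^ (i.2 : ℕ)) t) * expPoly (β i'.1) (X ^ (i'.2 : ℕ)) s) := by
  have h1 : expPolyKernel β P (t + s) =
      ∑ m, (P (σ m)).eval ((t + s : ℝ) : ℂ) * Complex.exp (-(β (σ m)) * (t + s : ℝ)) :=
    ((hσ.involutive hβ).bijective.sum_comp
      fun m => (P m).eval ((t + s : ℝ) : ℂ) * Complex.exp (-(β m) * (t + s : ℝ))).symm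
  rw [h1, Fintype.sum_sigma]
  refine Finset.sum_congr rfl fun m _ => ?_
  have hr (f : ℕ → ℂ) : ∑ k : Fin ((P (σ m)).natDegree + 1), f k =
      ∑ k ∈ Finset.range ((P m).natDegree + 1), f k := by
    rw [← hσ.natDegree_eq m, Finset.sum_range]
  have h2 (j : Fin ((P m).natDegree + 1)) :
      (∑ i' : TermIndex P, kernelMatrix P σ ⟨m, j⟩ i' *
        (conj (expPoly (β m) (X ^ (j : ℕ)) t) * expPoly (β i'.1) (X ^ (i'.2 : ℕ)) s)) =
      ∑ k ∈ Finset.range ((P m).natDegree + 1), (P (σ m)).coeff (j + k) *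
        ((j + k : ℕ).choose j : ℂ) * (t : ℂ) ^ (j : ℕ) * (s : ℂ) ^ k *
          Complex.exp (-(β (σ m)) * (t + s : ℝ)) := by
    rw [Fintype.sum_sigma, Finset.sum_eq_single (σ m), ← hr]
    · refine Finset.sum_congr rfl fun k _ => ?_
      rw [kernelMatrix, if_pos rfl, conj_expPoly, ← hσ.exponent, expPoly, expPoly]
      simp only [Polynomial.map_pow, map_X, eval_pow, eval_X, Complex.ofReal_add, mul_add,
        Complex.exp_add]
      ring
    · intro m' _ hm'
      refine Finset.sum_eq_zero fun k _ => ?_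
      rw [kernelMatrix, if_neg hm', zero_mul]
    · exact fun h => absurd (Finset.mem_univ _) h
  simp_rw [h2]
  rw [Complex.ofReal_add, eval_add_eq_sum _ (n := (P m).natDegree + 1)
    (by rw [hσ.natDegree_eq]; exact Nat.lt_succ_self _), Finset.sum_mul, Finset.sum_range]
  refine Finset.sum_congr rfl fun j _ => ?_
  rw [Finset.sum_mul]

theorem kernelMatrix_isHermitian {β : Fin M → ℂ} {P : Fin M → ℂ[X]} {σ : Fin M → Fin M}
    (hβ : Function.Injective β) (hσ : IsConjPairing β P σ) : (kernelMatrix P σ).IsHermitian := by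
  ext i i'
  rw [Matrix.conjTranspose_apply]
  by_cases h : i'.1 = σ i.1
  · have h' : i.1 = σ i'.1 := by rw [h, hσ.involutive hβ]
    have hc (n : ℕ) : (P i'.1).coeff n = star ((P i.1).coeff n) := by
      rw [h, hσ.coeff_eq, Complex.star_def]
    rw [kernelMatrix, kernelMatrix, if_pos h, if_pos h', hc, star_mul', add_comm (i.2 : ℕ),
      Nat.choose_symm_add]
    simp
  · have h' : i.1 ≠ σ i'.1 := fun h' => h (by rw [h', hσ.involutive hβ])
    rw [kernelMatrix, kernelMatrix, if_neg h, if_neg h', star_zero]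

/-- The blocks are skew-triangular with nonzero entries on the skew diagonal. -/
theorem kernelMatrix_injective {β : Fin M → ℂ} {P : Fin M → ℂ[X]} {σ : Fin M → Fin M}
    (hβ : Function.Injective β) (hP : ∀ m, P m ≠ 0) (hσ : IsConjPairing β P σ)
    {a : TermIndex P → ℂ} (ha : (kernelMatrix P σ).mulVec a = 0) : a = 0 := by
  suffices h : ∀ (m : Fin M) (n : ℕ) (k : Fin ((P m).natDegree + 1)), (k : ℕ) = n → a ⟨m, k⟩ = 0 by
    funext ⟨m, k⟩
    exact h m k k rfl
  intro m n
  induction n using Nat.strong_induction_on with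
  | _ n ih =>
    rintro k rfl
    have hk : (k : ℕ) ≤ (P m).natDegree := Nat.lt_succ_iff.1 k.2
    let j : Fin ((P (σ m)).natDegree + 1) :=
      ⟨(P m).natDegree - k, by rw [hσ.natDegree_eq]; exact Nat.lt_succ_of_le (Nat.sub_le _ _)⟩
    -- in this row all entries to the right of the skew diagonal vanish
    have hrow := congrFun ha ⟨σ m, j⟩
    have hsum : ∑ i', kernelMatrix P σ ⟨σ m, j⟩ i' * a i' = 0 := hrow
    have hjk : (j : ℕ) + k = (P m).natDegree := Nat.sub_add_cancel hk
    rw [Finset.sum_eq_single ⟨m, k⟩] at hsum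
    · rw [kernelMatrix, if_pos (hσ.involutive hβ m).symm] at hsum
      refine (mul_eq_zero.1 hsum).resolve_left (mul_ne_zero ?_ ?_)
      · rw [hjk]
        exact leadingCoeff_ne_zero.2 (hP m)
      · exact_mod_cast (Nat.choose_pos (Nat.le_add_right _ _)).ne'
    · rintro ⟨m', k'⟩ _ hne
      by_cases hm' : m' = m
      · subst hm'
        rcases lt_trichotomy (k' : ℕ) k with h | h | h
        · rw [ih k' h k' rfl, mul_zero]
        · exact absurd (by rw [Fin.ext h]) hne
        · rw [kernelMatrix, if_pos (hσ.involutive hβ m').symm,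
            coeff_eq_zero_of_natDegree_lt (by simp only; omega), zero_mul, zero_mul]
      · rw [kernelMatrix, if_neg (by rw [hσ.involutive hβ]; exact hm'), zero_mul]
    · exact fun h => absurd (Finset.mem_univ _) h

/-- The coordinates whose vanishing makes the form of the kernel matrix nonnegative. -/
def negCoords (β : Fin M → ℂ) (P : Fin M → ℂ[X]) : Finset (TermIndex P) :=
  {i | if (β i.1).im = 0 then (i.2 : ℕ) < realTermCount (P i.1) else 0 < (β i.1).im}

/-- The coordinates whose vanishing makes the form of the kernel matrix nonpositive. -/
def posCoords (β : Fin M → ℂ) (P : Fin M → ℂ[X]) : Finset (TermIndex P) :=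
  {i | if (β i.1).im = 0 then (i.2 : ℕ) < (P i.1).natDegree + 1 - realTermCount (P i.1)
    else (β i.1).im < 0}

theorem realTermCount_le (p : ℂ[X]) : realTermCount p ≤ p.natDegree + 1 := by
  unfold realTermCount
  split_ifs <;> omega

theorem card_filter_val_lt {n r : ℕ} (h : r ≤ n) :
    (Finset.univ.filter fun k : Fin n => (k : ℕ) < r).card = r := by
  rw [Fin.card_filter_val_lt, min_eq_right h]

theorem card_negCoords (β : Fin M → ℂ) (P : Fin M → ℂ[X]) :
    (negCoords β P).card = totalCount β P := by
  rw [negCoords, Finset.card_filter, Fintype.sum_sigma, totalCount, Finset.sum_filter,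
    Finset.sum_filter, ← Finset.sum_add_distrib]
  refine Finset.sum_congr rfl fun m _ => ?_
  rw [← Finset.card_filter]
  by_cases h0 : (β m).im = 0
  · simp only [h0, if_true, lt_irrefl, if_false, add_zero]
    exact card_filter_val_lt (realTermCount_le _)
  · by_cases h1 : 0 < (β m).im <;> simp [h0, h1]

theorem card_negCoords_add (β : Fin M → ℂ) (P : Fin M → ℂ[X]) :
    (negCoords β P).card + (posCoords β P).card = Fintype.card (TermIndex P) := by
  rw [negCoords, posCoords, Finset.card_filter, Finset.card_filter, Fintype.sum_sigma,
    Fintype.sum_sigma, Fintype.card_sigma, ← Finset.sum_add_distrib]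
  refine Finset.sum_congr rfl fun m _ => ?_
  rw [← Finset.card_filter, ← Finset.card_filter, Fintype.card_fin]
  have hle := realTermCount_le (P m)
  rcases lt_trichotomy (β m).im 0 with h | h | h
  · simp [h.ne, h, h.not_gt]
  · simp only [h, if_true]
    rw [card_filter_val_lt hle, card_filter_val_lt (Nat.sub_le _ _)]
    omega
  · simp [h.ne', h, h.not_gt]

/-- The diagonal of the form of a matrix `S`, as a double sum. -/
def matrixForm {ι : Type*} [Fintype ι] (S : Matrix ι ι ℂ) (a : ι → ℂ) : ℂ :=
  ∑ i, ∑ i', S i i' * (conj (a i) * a i')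

variable {β : Fin M → ℂ} {P : Fin M → ℂ[X]} {σ : Fin M → Fin M}

/-- Suppose that `a` vanishes at the coordinates with `k < r m` for real `βₘ`, where `2 r m ≥ Kₘ`,
and at all coordinates with `βₘ` in one of the open half-planes (given by `Q`). A nonzero term of
the matrix form then lies at the centre of a block of even degree of a real exponent, and its
sign is that of the leading coefficient of the polynomial. -/
theorem kernelMatrix_term (hβ : Function.Injective β) (hσ : IsConjPairing β P σ)
    {a : TermIndex P → ℂ} (i i' : TermIndex P) {Q : ℝ → Prop}
    (hQ : ∀ x : ℝ, x ≠ 0 → Q x ∨ Q (-x)) (r : Fin M → ℕ)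
    (hr : ∀ m, (P m).natDegree ≤ 2 * r m)
    (ha : ∀ i : TermIndex P, (β i.1).im = 0 → (i.2 : ℕ) < r i.1 → a i = 0)
    (ha' : ∀ i : TermIndex P, (β i.1).im ≠ 0 → Q (β i.1).im → a i = 0)
    (hne : kernelMatrix P σ i i' * (conj (a i) * a i') ≠ 0) :
    2 * r i.1 = (P i.1).natDegree ∧ (P i.1).leadingCoeff.im = 0 ∧
      ∃ x : ℝ, 0 ≤ x ∧ kernelMatrix P σ i i' * (conj (a i) * a i') =
        (P i.1).leadingCoeff * (x : ℂ) := by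
  obtain ⟨m, j⟩ := i
  obtain ⟨m', k⟩ := i'
  have hS := left_ne_zero_of_mul hne
  have hai : a ⟨m, j⟩ ≠ 0 := fun h => right_ne_zero_of_mul hne (by rw [h, map_zero, zero_mul])
  have hai' : a ⟨m', k⟩ ≠ 0 := fun h => right_ne_zero_of_mul hne (by rw [h, mul_zero])
  have hm' : m' = σ m := by
    by_contra h
    exact hS (if_neg h)
  have him : (β m).im = 0 := by
    by_contra h
    rcases hQ _ h with h1 | h1
    · exact hai (ha' ⟨m, j⟩ h h1)
    · have h2 : (β m').im = -(β m).im := by rw [hm', hσ.im_eq]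
      exact hai' (ha' ⟨m', k⟩ (by simpa [h2] using h) (by simpa [h2] using h1))
  rw [hσ.apply_eq_self hβ him] at hm'
  subst hm'
  have hj : r m' ≤ j := not_lt.1 fun h => hai (ha ⟨m', j⟩ him h)
  have hk : r m' ≤ k := not_lt.1 fun h => hai' (ha ⟨m', k⟩ him h)
  have hSeq : kernelMatrix P σ ⟨m', j⟩ ⟨m', k⟩ =
      (P m').coeff (j + k) * ((j + k : ℕ).choose j : ℂ) :=
    if_pos (hσ.apply_eq_self hβ him).symm
  have hle : (j : ℕ) + k ≤ (P m').natDegree := by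
    by_contra h
    rw [hSeq, coeff_eq_zero_of_natDegree_lt (not_le.1 h), zero_mul] at hS
    exact hS rfl
  have hrm := hr m'
  have hjk : j = k := Fin.ext (by omega)
  subst hjk
  have hlead : (P m').leadingCoeff.im = 0 := by
    rw [← Complex.conj_eq_iff_im, leadingCoeff, ← hσ.coeff_eq, hσ.apply_eq_self hβ him]
  refine ⟨by simp only; omega, hlead,
    ((j + j : ℕ).choose j : ℝ) * Complex.normSq (a ⟨m', j⟩),
    mul_nonneg (Nat.cast_nonneg _) (Complex.normSq_nonneg _), ?_⟩
  rw [hSeq, leadingCoeff, show (j : ℕ) + j = (P m').natDegree by omega, mul_comm (conj _),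
    Complex.mul_conj]
  push_cast
  ring

theorem matrixForm_nonneg (hβ : Function.Injective β) (hσ : IsConjPairing β P σ)
    {a : TermIndex P → ℂ} (ha : ∀ i ∈ negCoords β P, a i = 0) :
    0 ≤ (matrixForm (kernelMatrix P σ) a).re := by
  have hr (m : Fin M) : (P m).natDegree ≤ 2 * (realTermCount (P m)) := by
    unfold realTermCount
    split_ifs <;> grind
  rw [matrixForm, Complex.re_sum]
  refine Finset.sum_nonneg fun i _ => ?_
  rw [Complex.re_sum]
  refine Finset.sum_nonneg fun i' _ => ?_
  by_cases hne : kernelMatrix P σ i i' * (conj (a i) * a i') = 0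
  · rw [hne, Complex.zero_re]
  obtain ⟨h1, h2, x, hx, h3⟩ := kernelMatrix_term hβ hσ i i' (Q := fun x => 0 < x)
    (fun x hx => by rcases hx.lt_or_gt with h | h <;> [right; left] <;> linarith)
    (fun m => realTermCount (P m)) hr
    (fun i h0 hi => ha i (by simp [negCoords, h0, hi]))
    (fun i h0 hi => ha i (by simp [negCoords, h0, hi])) hne
  rw [h3, Complex.re_mul_ofReal]
  have h4 : 0 < (P i.1).leadingCoeff.re := by
    by_contra h
    unfold realTermCount at h1
    split_ifs at h1 <;> grind
  positivity

theorem matrixForm_nonpos (hβ : Function.Injective β) (hσ : IsConjPairing β P σ)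
    {a : TermIndex P → ℂ} (ha : ∀ i ∈ posCoords β P, a i = 0) :
    (matrixForm (kernelMatrix P σ) a).re ≤ 0 := by
  have hr (m : Fin M) : (P m).natDegree ≤ 2 * ((P m).natDegree + 1 - realTermCount (P m)) := by
    unfold realTermCount
    split_ifs <;> grind
  rw [matrixForm, Complex.re_sum]
  refine Finset.sum_nonpos fun i _ => ?_
  rw [Complex.re_sum]
  refine Finset.sum_nonpos fun i' _ => ?_
  by_cases hne : kernelMatrix P σ i i' * (conj (a i) * a i') = 0
  · rw [hne, Complex.zero_re]
  obtain ⟨h1, h2, x, hx, h3⟩ := kernelMatrix_term hβ hσ i i' (Q := fun x => x < 0)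
    (fun x hx => by rcases hx.lt_or_gt with h | h <;> [left; right] <;> linarith)
    (fun m => (P m).natDegree + 1 - realTermCount (P m)) hr
    (fun i h0 hi => ha i (by simp [posCoords, h0, hi]))
    (fun i h0 hi => ha i (by simp [posCoords, h0, hi])) hne
  rw [h3, Complex.re_mul_ofReal]
  have h4 : (P i.1).leadingCoeff.re ≤ 0 := by
    by_contra h
    unfold realTermCount at h1
    split_ifs at h1 <;> grind
  exact mul_nonpos_of_nonpos_of_nonneg h4 hx

end Coefficients

/-! ### Signature of a Hermitian matrix -/

section Signature

variable {ι : Type*} [Fintype ι]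

theorem matrixForm_eq_inner (S : Matrix ι ι ℂ) (a : ι → ℂ) :
    matrixForm S a =
      inner ℂ (WithLp.toLp 2 a : EuclideanSpace ℂ ι) (WithLp.toLp 2 (S.mulVec a)) := by
  rw [PiLp.inner_apply]
  refine Finset.sum_congr rfl fun i _ => ?_
  change _ = (∑ i', S i i' * a i') * conj (a i)
  rw [Finset.sum_mul]
  refine Finset.sum_congr rfl fun i' _ => ?_
  ring

variable [DecidableEq ι]

/-- In an orthonormal eigenbasis, the form of a Hermitian matrix is diagonal. -/
theorem matrixForm_sum_eigenvectorBasis {S : Matrix ι ι ℂ} (hS : S.IsHermitian) (c : ι → ℂ) :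
    (matrixForm S (∑ k, c k • (hS.eigenvectorBasis k).ofLp)).re =
      ∑ k, hS.eigenvalues k * ‖c k‖ ^ 2 := by
  rw [matrixForm_eq_inner]
  have h1 : (WithLp.toLp 2 (∑ k, c k • (hS.eigenvectorBasis k).ofLp) : EuclideanSpace ℂ ι) =
      ∑ k, c k • hS.eigenvectorBasis k := by
    simp
  have h2 : (WithLp.toLp 2 (S.mulVec (∑ k, c k • (hS.eigenvectorBasis k).ofLp)) :
      EuclideanSpace ℂ ι) = ∑ k, (c k * hS.eigenvalues k) • hS.eigenvectorBasis k := by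
    rw [Matrix.mulVec_sum, WithLp.toLp_sum]
    refine Finset.sum_congr rfl fun k _ => ?_
    rw [Matrix.mulVec_smul, hS.mulVec_eigenvectorBasis, mul_smul]
    rfl
  rw [h1, h2, hS.eigenvectorBasis.orthonormal.inner_sum, Complex.re_sum]
  refine Finset.sum_congr rfl fun k _ => ?_
  rw [← mul_assoc, Complex.conj_mul', ← Complex.ofReal_pow, ← Complex.ofReal_mul,
    Complex.ofReal_re, mul_comm]

theorem matrixForm_sum_subtype {S : Matrix ι ι ℂ} (hS : S.IsHermitian) (p : ι → Prop)
    [DecidablePred p] (c : {k // p k} → ℂ) :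
    (matrixForm S (∑ k, c k • (hS.eigenvectorBasis k).ofLp)).re =
      ∑ k : {k // p k}, hS.eigenvalues k * ‖c k‖ ^ 2 := by
  let c' : ι → ℂ := fun k => if h : p k then c ⟨k, h⟩ else 0
  have hc (k : {k // p k}) : c' k = c k := dif_pos k.2
  have hc' (k : {k // ¬ p k}) : c' k = 0 := dif_neg k.2
  have h1 := matrixForm_sum_eigenvectorBasis hS c'
  rw [← Fintype.sum_subtype_add_sum_subtype p fun k => c' k • (hS.eigenvectorBasis k).ofLp,
    ← Fintype.sum_subtype_add_sum_subtype p fun k => hS.eigenvalues k * ‖c' k‖ ^ 2] at h1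
  simpa [hc, hc'] using h1

/-- Lower bound for the number of negative eigenvalues of a nondegenerate Hermitian matrix: the
span of the eigenvectors with positive eigenvalues has trivial intersection with any subspace on
which the form is nonpositive. -/
theorem card_le_card_neg_eigenvalues {S : Matrix ι ι ℂ} (hS : S.IsHermitian)
    (hinj : ∀ a, S.mulVec a = 0 → a = 0) (Z' : Finset ι)
    (hZ' : ∀ a : ι → ℂ, (∀ i ∈ Z', a i = 0) → (matrixForm S a).re ≤ 0) :
    Fintype.card ι ≤ Fintype.card {k // hS.eigenvalues k < 0} + Z'.card := by
  have hne (k) : hS.eigenvalues k ≠ 0 := fun h0 => by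
    have h1 := hS.mulVec_eigenvectorBasis k
    rw [h0, zero_smul] at h1
    have h2 := hS.eigenvectorBasis.orthonormal.1 k
    have h3 : hS.eigenvectorBasis k = 0 := WithLp.ofLp_injective 2 (hinj _ h1)
    rw [h3, norm_zero] at h2
    exact zero_ne_one h2
  let A := {k // ¬ hS.eigenvalues k < 0}
  let φ : (A → ℂ) →ₗ[ℂ] (Z' → ℂ) :=
    LinearMap.funLeft ℂ ℂ (Subtype.val : Z' → ι) ∘ₗ
      Fintype.linearCombination ℂ (fun k : A => (hS.eigenvectorBasis k).ofLp)
  have hφ : Function.Injective φ := by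
    refine (injective_iff_map_eq_zero φ).2 fun c hc => ?_
    have h1 := hZ' (∑ k : A, c k • (hS.eigenvectorBasis k).ofLp) fun i hi => congrFun hc ⟨i, hi⟩
    rw [matrixForm_sum_subtype hS (fun k => ¬ hS.eigenvalues k < 0)] at h1
    have hnn (k : A) : 0 ≤ hS.eigenvalues k * ‖c k‖ ^ 2 :=
      mul_nonneg (not_lt.1 k.2) (by positivity)
    have h2 := (Finset.sum_eq_zero_iff_of_nonneg fun k _ => hnn k).1
      (le_antisymm h1 (Finset.sum_nonneg fun k _ => hnn k))
    funext k
    have h3 := (mul_eq_zero.1 (h2 k (Finset.mem_univ _))).resolve_left (hne k)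
    simpa using h3
  have h1 := LinearMap.finrank_le_finrank_of_injective hφ
  rw [Module.finrank_fintype_fun_eq_card, Module.finrank_fintype_fun_eq_card,
    Fintype.card_coe] at h1
  have h2 := Fintype.card_subtype_compl (fun k => hS.eigenvalues k < 0)
  have h3 := Fintype.card_subtype_le (fun k => hS.eigenvalues k < 0)
  change Fintype.card {k // ¬ hS.eigenvalues k < 0} ≤ _ at h1
  omega

end Signature

/-! ### Prescribing coordinates with a small unperturbed form -/

section Lifting

variable {E F ι : Type*} [AddCommGroup E] [Module ℂ E] [NormedAddCommGroup F]
  [InnerProductSpace ℂ F] [CompleteSpace F] [Fintype ι]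

/-- If no nontrivial linear combination of the functionals `l i` is bounded by the seminorm `‖L f‖`,
their values can be prescribed at some `f` with arbitrarily small `‖L f‖`: the
image under `L` of the common kernel is dense in the range of `L`. -/
theorem exists_small_of_independent (L : E →ₗ[ℂ] F) (l : ι → E →ₗ[ℂ] ℂ)
    (hl : ∀ (w : F) (c : ι → ℂ), (∀ f, inner ℂ w (L f) = ∑ i, c i * l i f) → c = 0)
    (x : ι → ℂ) {ε : ℝ} (hε : 0 < ε) : ∃ f, (∀ i, l i f = x i) ∧ ‖L f‖ < ε := by
  classical
  have hsurj : LinearMap.range (LinearMap.pi l) = ⊤ := by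
    by_contra hne
    obtain ⟨φ, hφ, hker⟩ := Submodule.exists_le_ker_of_lt_top _ (lt_top_iff_ne_top.2 hne)
    have hφe (y : ι → ℂ) : φ y = ∑ i, φ (Pi.single i 1) * y i := by
      conv_lhs => rw [pi_eq_sum_univ' y, map_sum]
      exact Finset.sum_congr rfl fun i _ => by rw [map_smul, smul_eq_mul, mul_comm]
    have h0 := hl 0 (fun i => φ (Pi.single i 1)) fun f => by
      rw [inner_zero_left, ← hφe (fun i => l i f)]
      exact (hker ⟨f, rfl⟩ : LinearMap.pi l f ∈ LinearMap.ker φ).symm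
    refine hφ (LinearMap.ext fun y => ?_)
    rw [hφe]
    exact Finset.sum_eq_zero fun i _ => by rw [congrFun h0 i, Pi.zero_apply, zero_mul]
  obtain ⟨f₀, hf₀⟩ : x ∈ LinearMap.range (LinearMap.pi l) := hsurj ▸ Submodule.mem_top
  let N : Submodule ℂ F := (⨅ i, LinearMap.ker (l i)).map L
  have hmem : L f₀ ∈ N.topologicalClosure := by
    rw [← Submodule.orthogonal_orthogonal_eq_closure, Submodule.mem_orthogonal]
    intro w hw
    let φ : E →ₗ[ℂ] ℂ := (innerSL ℂ w : F →ₗ[ℂ] ℂ) ∘ₗ L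
    have hker : ⨅ i, LinearMap.ker (l i) ≤ LinearMap.ker φ := fun f hf =>
      Submodule.inner_left_of_mem_orthogonal (Submodule.mem_map_of_mem hf) hw
    obtain ⟨c, hc⟩ := (Submodule.mem_span_range_iff_exists_fun ℂ).1
      (mem_span_of_iInf_ker_le_ker hker)
    have hφ (f : E) : inner ℂ w (L f) = ∑ i, c i * l i f := by
      have := congrArg (fun ψ : E →ₗ[ℂ] ℂ => ψ f) hc
      simpa [φ] using this.symm
    rw [hφ, hl w c hφ]
    simp
  obtain ⟨_, ⟨g, hg, rfl⟩, hgε⟩ := Metric.mem_closure_iff.1 hmem ε hε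
  refine ⟨f₀ - g, fun i => ?_, ?_⟩
  · have h1 : l i g = 0 := (Submodule.mem_iInf _).1 hg i
    rw [map_sub, h1, sub_zero, ← hf₀]
    rfl
  · rwa [map_sub, ← dist_eq_norm]

end Lifting

/-! ### The Hankel operator of an exponential polynomial -/

section FiniteRank

variable {M : ℕ} {β : Fin M → ℂ} {P : Fin M → ℂ[X]} {σ : Fin M → Fin M}

theorem memLp_expPoly_X_pow {b : ℂ} (hb : 0 < b.re) (k : ℕ) :
    MemLp (expPoly b (X ^ k)) 2 halfLine := by
  rw [memLp_two_iff_integrable_sq_norm (continuous_expPoly b _).aestronglyMeasurable]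
  have h1 := integrableOn_rpow_mul_exp_neg_mul_rpow (s := (2 * k : ℕ)) (p := 1) (b := 2 * b.re)
    (by linarith [(Nat.cast_nonneg (2 * k) : (0 : ℝ) ≤ ((2 * k : ℕ) : ℝ))]) one_pos (by positivity)
  refine h1.congr_fun (fun t ht => ?_) measurableSet_Ioi
  have ht : 0 < t := ht
  simp only [expPoly, eval_pow, eval_X, norm_mul, norm_pow, Complex.norm_real, Real.rpow_natCast,
    Complex.norm_exp, Real.rpow_one]
  rw [Real.norm_of_nonneg ht.le, mul_pow, ← pow_mul, ← Real.exp_nat_mul, mul_comm k 2]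
  congr 2
  simp
  ring

/-- The function `t ^ k e^{- conj(βₘ) t}`; the inner products with these functions are the
coordinates in which the form `(V f, f)` is given by the kernel matrix. -/
def dualVector (hβ : ∀ m, 0 < (β m).re) (i : TermIndex P) : L2 :=
  (memLp_star (memLp_expPoly_X_pow (hβ i.1) i.2)).toLp _

theorem inner_dualVector (hβ : ∀ m, 0 < (β m).re) (i : TermIndex P) (f : L2) :
    inner ℂ (dualVector hβ i) f = ∫ t, expPoly (β i.1) (X ^ (i.2 : ℕ)) t * f t ∂halfLine :=
  (integral_mul_eq_inner (memLp_expPoly_X_pow (hβ i.1) i.2) f).symm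

theorem coe_dualVector (hβ : ∀ m, 0 < (β m).re) (i : TermIndex P) :
    (dualVector hβ i : ℝ → ℂ) =ᵐ[halfLine] fun t => conj (expPoly (β i.1) (X ^ (i.2 : ℕ)) t) :=
  (memLp_star (memLp_expPoly_X_pow (hβ i.1) i.2)).coeFn_toLp

/-- The Hankel operator as a bounded operator of finite rank. -/
def finiteRankOperator (hβ : ∀ m, 0 < (β m).re) (P : Fin M → ℂ[X]) (σ : Fin M → Fin M) :
    L2 →L[ℂ] L2 :=
  ∑ i : TermIndex P, ∑ i' : TermIndex P,
    kernelMatrix P σ i i' • (innerSL ℂ (dualVector hβ i')).smulRight (dualVector hβ i)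

theorem finiteRankOperator_apply (hβ : ∀ m, 0 < (β m).re) (f : L2) :
    finiteRankOperator hβ P σ f = ∑ i : TermIndex P, ∑ i' : TermIndex P,
      (kernelMatrix P σ i i' * inner ℂ (dualVector hβ i') f) • dualVector hβ i := by
  simp only [finiteRankOperator, _root_.sum_apply, _root_.smul_apply,
    ContinuousLinearMap.smulRight_apply, innerSL_apply_apply, smul_smul]

theorem integrable_expPoly_mul (hβ : ∀ m, 0 < (β m).re) (i : TermIndex P) (f : L2) :
    Integrable (fun s => expPoly (β i.1) (X ^ (i.2 : ℕ)) s * f s) halfLine :=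
  (memLp_expPoly_X_pow (hβ i.1) i.2).integrable_mul (Lp.memLp f)

theorem expPolyKernel_mul (hinj : Function.Injective β) (hσ : IsConjPairing β P σ) (f : L2)
    (t s : ℝ) : expPolyKernel β P (t + s) * f s = ∑ i : TermIndex P, ∑ i' : TermIndex P,
      (kernelMatrix P σ i i' * conj (expPoly (β i.1) (X ^ (i.2 : ℕ)) t)) *
        (expPoly (β i'.1) (X ^ (i'.2 : ℕ)) s * f s) := by
  rw [expPolyKernel_add hinj hσ, Finset.sum_mul]
  refine Finset.sum_congr rfl fun i _ => ?_
  rw [Finset.sum_mul]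
  exact Finset.sum_congr rfl fun i' _ => by ring

theorem hankelIntegral_ae (hβ : ∀ m, 0 < (β m).re) (hinj : Function.Injective β)
    (hσ : IsConjPairing β P σ) (f : L2) :
    hankelIntegral (expPolyKernel β P) f =ᵐ[halfLine] finiteRankOperator hβ P σ f := by
  have h1 (t : ℝ) : hankelIntegral (expPolyKernel β P) f t =
      ∑ i : TermIndex P, ∑ i' : TermIndex P,
        (kernelMatrix P σ i i' * conj (expPoly (β i.1) (X ^ (i.2 : ℕ)) t)) *
          inner ℂ (dualVector hβ i') f := by
    simp_rw [hankelIntegral, expPolyKernel_mul hinj hσ, inner_dualVector]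
    rw [integral_finsetSum _ fun i _ => integrable_finsetSum _ fun i' _ =>
      (integrable_expPoly_mul hβ i' f).const_mul _]
    refine Finset.sum_congr rfl fun i _ => ?_
    rw [integral_finsetSum _ fun i' _ => (integrable_expPoly_mul hβ i' f).const_mul _]
    exact Finset.sum_congr rfl fun i' _ => integral_const_mul _ _
  rw [finiteRankOperator_apply]
  simp_rw [← Finset.sum_smul]
  have h2 := Lp.coeFn_finsetSum (p := 2) (μ := halfLine) Finset.univ fun i : TermIndex P =>
    (∑ i' : TermIndex P, kernelMatrix P σ i i' * inner ℂ (dualVector hβ i') f) • dualVector hβ i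
  filter_upwards [h2, ae_all_iff.2 fun i : TermIndex P => coe_dualVector hβ i,
    ae_all_iff.2 fun i : TermIndex P => Lp.coeFn_smul
      (∑ i' : TermIndex P, kernelMatrix P σ i i' * inner ℂ (dualVector hβ i') f)
      (dualVector hβ i)] with t ht ht1 ht2
  rw [ht, h1, Finset.sum_apply]
  refine Finset.sum_congr rfl fun i _ => ?_
  rw [ht2, Pi.smul_apply, ht1, smul_eq_mul, Finset.sum_mul]
  exact Finset.sum_congr rfl fun i' _ => by ring

theorem mem_hankelDomain (hβ : ∀ m, 0 < (β m).re) (hinj : Function.Injective β)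
    (hσ : IsConjPairing β P σ) (f : L2) : f ∈ hankelDomain (expPolyKernel β P) := by
  refine ⟨ae_of_all _ fun t => ?_,
    (memLp_congr_ae (hankelIntegral_ae hβ hinj hσ f)).2 (Lp.memLp _)⟩
  simp_rw [expPolyKernel_mul hinj hσ]
  exact integrable_finsetSum _ fun i _ => integrable_finsetSum _ fun i' _ =>
    (integrable_expPoly_mul hβ i' f).const_mul _

theorem hankelOperator_apply (hβ : ∀ m, 0 < (β m).re) (hinj : Function.Injective β)
    (hσ : IsConjPairing β P σ) (f : (hankelOperator (expPolyKernel β P)).domain) :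
    (hankelOperator (expPolyKernel β P)).toFun f = finiteRankOperator hβ P σ (f : L2) :=
  Lp.ext ((MemLp.coeFn_toLp f.2.2).trans (hankelIntegral_ae hβ hinj hσ f))

theorem inner_finiteRankOperator (hβ : ∀ m, 0 < (β m).re) (f g : L2) :
    inner ℂ g (finiteRankOperator hβ P σ f) = ∑ i : TermIndex P, ∑ i' : TermIndex P,
      kernelMatrix P σ i i' *
        (conj (inner ℂ (dualVector hβ i) g) * inner ℂ (dualVector hβ i') f) := by
  rw [finiteRankOperator_apply, inner_sum]
  refine Finset.sum_congr rfl fun i _ => ?_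
  rw [inner_sum]
  refine Finset.sum_congr rfl fun i' _ => ?_
  rw [inner_smul_right, inner_conj_symm]
  ring

theorem inner_finiteRankOperator_self (hβ : ∀ m, 0 < (β m).re) (f : L2) :
    inner ℂ f (finiteRankOperator hβ P σ f) =
      matrixForm (kernelMatrix P σ) fun i => inner ℂ (dualVector hβ i) f :=
  inner_finiteRankOperator hβ f f

theorem finiteRankOperator_symm (hβ : ∀ m, 0 < (β m).re) (hinj : Function.Injective β)
    (hσ : IsConjPairing β P σ) (f g : L2) :
    inner ℂ (finiteRankOperator hβ P σ f) g = inner ℂ f (finiteRankOperator hβ P σ g) := by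
  rw [← inner_conj_symm, inner_finiteRankOperator, inner_finiteRankOperator, map_sum]
  simp_rw [map_sum]
  rw [Finset.sum_comm]
  refine Finset.sum_congr rfl fun i _ => Finset.sum_congr rfl fun i' _ => ?_
  have h1 : conj (kernelMatrix P σ i' i) = kernelMatrix P σ i i' :=
    (kernelMatrix_isHermitian hinj hσ).apply i i'
  rw [map_mul, map_mul, Complex.conj_conj, h1]
  ring

end FiniteRank

/-! ### Bounds for the negative index -/

section NegIndexBounds

variable {E : Type} [NormedAddCommGroup E] [InnerProductSpace ℂ E] {D : Submodule ℂ E}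
  {h : SesqForm D}

theorem negIndex_le_card {Z : Type} [Fintype Z] (ψ : D →ₗ[ℂ] (Z → ℂ))
    (hψ : ∀ f, ψ f = 0 → 0 ≤ (h f f).re) : negIndex h ≤ Fintype.card Z := by
  refine negIndex_le fun K hK => ?_
  have hinj : Function.Injective (ψ ∘ₗ K.subtype) := by
    refine (injective_iff_map_eq_zero _).2 fun f hf => ?_
    by_contra hne
    have h1 := hψ f hf
    have h2 := hK f f.2 fun h0 => hne (Subtype.ext h0)
    linarith
  have h1 := LinearMap.rank_le_of_injective _ hinj
  rw [rank_fun'] at h1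
  exact Cardinal.toENat_le_natCast.2 h1

theorem card_le_negIndex {κ : Type} [Fintype κ] (φ : (κ → ℂ) →ₗ[ℂ] D)
    (hφ : ∀ c, c ≠ 0 → (h (φ c) (φ c)).re < 0) : (Fintype.card κ : ℕ∞) ≤ negIndex h := by
  have hinj : Function.Injective φ := by
    refine (injective_iff_map_eq_zero _).2 fun c hc => ?_
    by_contra hne
    have h1 := hφ c hne
    rw [hc, map_zero, Complex.zero_re] at h1
    exact lt_irrefl _ h1
  have h1 := (LinearEquiv.ofInjective φ hinj).rank_eq
  rw [rank_fun'] at h1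
  rw [← map_natCast Cardinal.toENat, h1]
  refine rank_le_negIndex _ ?_
  rintro _ ⟨c, rfl⟩ hne
  exact hφ c fun h0 => hne (by rw [h0, map_zero])

end NegIndexBounds

/-! ### The perturbed form -/

section Perturbation

variable {M : ℕ} {β : Fin M → ℂ} {P : Fin M → ℂ[X]} {σ : Fin M → Fin M} {σ₀ : ℝ → ℝ}

/-- No nontrivial linear combination of the coordinate functionals is bounded by the unperturbed
form. -/
theorem coords_independent (hσ₀ : IsAdmissibleSigma σ₀) (hβ : ∀ m, 0 < (β m).re)
    (hinj : Function.Injective β) (w : Lp ℂ 2 (sigmaMeasure σ₀)) (c : TermIndex P → ℂ)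
    (hw : ∀ f : laplaceDomain σ₀, inner ℂ w ((laplaceOperator σ₀).toFun f) =
      ∑ i, c i * inner ℂ (dualVector hβ i) (f : L2)) : c = 0 := by
  let p : Fin M → ℂ[X] := fun m =>
    ∑ k : Fin ((P m).natDegree + 1), Polynomial.C (c ⟨m, k⟩) * X ^ (k : ℕ)
  let s : Finset ℂ := Finset.univ.image β
  have hs (m) : β m ∈ s := Finset.mem_image_of_mem _ (Finset.mem_univ _)
  have hsum (t : ℝ) : ∑ b ∈ s, expPoly b (expCoeff β p b) t =
      ∑ i : TermIndex P, c i * expPoly (β i.1) (X ^ (i.2 : ℕ)) t := by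
    rw [sum_expCoeff β p s hs, Fintype.sum_sigma]
    refine Finset.sum_congr rfl fun m _ => ?_
    rw [expPoly, eval_finsetSum, Finset.sum_mul]
    refine Finset.sum_congr rfl fun k _ => ?_
    rw [eval_mul, eval_C, expPoly, mul_assoc]
  have hzero := expPoly_sum_eq_zero_of_bounded hσ₀ w s (expCoeff β p) fun f => by
    rw [hw]
    simp_rw [hsum, Finset.sum_mul, inner_dualVector, mul_assoc]
    rw [integral_finsetSum _ fun i _ => (integrable_expPoly_mul hβ i _).const_mul _]
    exact Finset.sum_congr rfl fun i _ => (integral_const_mul _ _).symm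
  have hp := eq_zero_of_sum_expPoly_eq_zero s (expCoeff β p) hzero
  funext ⟨m, k⟩
  have h1 := hp _ (hs m)
  rw [expCoeff_apply hinj] at h1
  have h2 := congrArg (fun q : ℂ[X] => q.coeff k) h1
  simpa [p, finsetSum_coeff, coeff_C_mul, coeff_X_pow, Fin.val_inj] using h2

/-- The Laplace transform restricted to the domain of the perturbed form. -/
def laplaceOn (σ₀ : ℝ → ℝ) (v : ℝ → ℂ) : perturbedFormDomain σ₀ v →ₗ[ℂ] Lp ℂ 2 (sigmaMeasure σ₀) :=
  (laplaceOperator σ₀).toFun ∘ₗ Submodule.inclusion inf_le_left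

theorem perturbedForm_apply (hβ : ∀ m, 0 < (β m).re) (hinj : Function.Injective β)
    (hσ : IsConjPairing β P σ) (f g : perturbedFormDomain σ₀ (expPolyKernel β P)) :
    perturbedForm σ₀ (expPolyKernel β P) f g =
      productForm (laplaceOn σ₀ (expPolyKernel β P)) (laplaceOn σ₀ (expPolyKernel β P)) f g +
        inner ℂ (g : L2) (finiteRankOperator hβ P σ (f : L2)) := by
  change _ + inner ℂ (g : L2) ((hankelOperator (expPolyKernel β P)).toFun _) = _
  rw [hankelOperator_apply hβ hinj hσ]
  rfl

theorem perturbedForm_self_re (hβ : ∀ m, 0 < (β m).re) (hinj : Function.Injective β)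
    (hσ : IsConjPairing β P σ) (f : perturbedFormDomain σ₀ (expPolyKernel β P)) :
    (perturbedForm σ₀ (expPolyKernel β P) f f).re =
      ‖laplaceOn σ₀ (expPolyKernel β P) f‖ ^ 2 +
        (matrixForm (kernelMatrix P σ) fun i => inner ℂ (dualVector hβ i) (f : L2)).re := by
  rw [perturbedForm_apply hβ hinj hσ, Complex.add_re, productForm_apply, re_inner_self,
    inner_finiteRankOperator_self]

theorem perturbedFormDomain_eq (hβ : ∀ m, 0 < (β m).re) (hinj : Function.Injective β)
    (hσ : IsConjPairing β P σ) :
    perturbedFormDomain σ₀ (expPolyKernel β P) = laplaceDomain σ₀ :=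
  inf_eq_left.2 fun f _ => mem_hankelDomain hβ hinj hσ f

/-- The coordinate functionals on the domain of the perturbed form. -/
def coord (σ₀ : ℝ → ℝ) (P : Fin M → ℂ[X]) (hβ : ∀ m, 0 < (β m).re) (i : TermIndex P) :
    perturbedFormDomain σ₀ (expPolyKernel β P) →ₗ[ℂ] ℂ :=
  (innerSL ℂ (dualVector hβ i) : L2 →ₗ[ℂ] ℂ) ∘ₗ Submodule.subtype _

theorem coord_apply (hβ : ∀ m, 0 < (β m).re) (i : TermIndex P)
    (f : perturbedFormDomain σ₀ (expPolyKernel β P)) :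
    coord σ₀ P hβ i f = inner ℂ (dualVector hβ i) (f : L2) := rfl

/-- Upper bound: on a negative subspace the coordinates in `negCoords` determine `f`. Lower bound:
functions with prescribed coordinates, namely negative eigenvectors of the kernel matrix, for which
the unperturbed form is small. -/
theorem negIndex_perturbedForm (hσ₀ : IsAdmissibleSigma σ₀) (hβ : ∀ m, 0 < (β m).re)
    (hinj : Function.Injective β) (hP : ∀ m, P m ≠ 0) (hσ : IsConjPairing β P σ) :
    negIndex (perturbedForm σ₀ (expPolyKernel β P)) = totalCount β P := by
  set L := laplaceOn σ₀ (expPolyKernel β P) with hL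
  have hre := perturbedForm_self_re (σ₀ := σ₀) hβ hinj hσ
  refine le_antisymm ?_ ?_
  · rw [← card_negCoords, ← Fintype.card_coe]
    refine negIndex_le_card (LinearMap.pi fun i : negCoords β P => coord σ₀ P hβ i) fun f hf => ?_
    rw [hre]
    have := matrixForm_nonneg hinj hσ (a := fun i => inner ℂ (dualVector hβ i) (f : L2))
      fun i hi => congrFun hf ⟨i, hi⟩
    positivity
  · have hS := kernelMatrix_isHermitian hinj hσ
    have hcard := card_le_card_neg_eigenvalues hS
      (fun a => kernelMatrix_injective hinj hP hσ) (posCoords β P)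
      (fun a => matrixForm_nonpos hinj hσ)
    rw [← card_negCoords_add β P, card_negCoords] at hcard
    set κ := {k // hS.eigenvalues k < 0} with hκ
    -- the `ε k` are so small that the unperturbed form does not spoil negativity
    let ε : κ → ℝ := fun k => √(-hS.eigenvalues k / (Fintype.card κ + 1))
    have hε (k : κ) : 0 < ε k :=
      Real.sqrt_pos.2 (div_pos (neg_pos.2 k.2) (by positivity))
    have hε2 (k : κ) : Fintype.card κ * ε k ^ 2 + hS.eigenvalues k < 0 := by
      have hk := k.2
      rw [Real.sq_sqrt (div_pos (neg_pos.2 hk) (by positivity)).le, mul_div_assoc']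
      have h1 : Fintype.card κ * -hS.eigenvalues k / (Fintype.card κ + 1) <
          -hS.eigenvalues k := by
        rw [div_lt_iff₀ (by positivity)]
        nlinarith
      linarith
    have hex (k : κ) : ∃ f, (∀ i, coord σ₀ P hβ i f = hS.eigenvectorBasis k i) ∧ ‖L f‖ < ε k := by
      refine exists_small_of_independent L (coord σ₀ P hβ) (fun w c hw => ?_) _ (hε k)
      exact coords_independent hσ₀ hβ hinj w c fun f =>
        hw ⟨f, (perturbedFormDomain_eq hβ hinj hσ).ge f.2⟩
    choose f hf hfε using hex
    have hneg := card_le_negIndex (h := perturbedForm σ₀ (expPolyKernel β P))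
      (Fintype.linearCombination ℂ f) fun c hc => by
        rw [Fintype.linearCombination_apply, hre]
        have h1 : (fun i => inner ℂ (dualVector hβ i)
            ((∑ k, c k • f k : perturbedFormDomain σ₀ (expPolyKernel β P)) : L2)) =
            ∑ k : κ, c k • (hS.eigenvectorBasis k).ofLp := by
          funext i
          rw [← coord_apply, map_sum, Finset.sum_apply]
          exact Finset.sum_congr rfl fun k _ => by rw [map_smul, hf]; rfl
        have h2 : ‖L (∑ k, c k • f k)‖ ^ 2 ≤ Fintype.card κ * ∑ k, (ε k * ‖c k‖) ^ 2 := by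
          refine le_trans ?_ (sq_sum_le_card_mul_sum_sq (s := Finset.univ)
            (f := fun k => ε k * ‖c k‖))
          gcongr
          rw [map_sum]
          refine (norm_sum_le _ _).trans (Finset.sum_le_sum fun k _ => ?_)
          rw [map_smul, norm_smul, mul_comm]
          gcongr
          exact (hfε k).le
        rw [h1, matrixForm_sum_subtype hS fun k => hS.eigenvalues k < 0]
        refine (add_le_add_left h2 _).trans_lt ?_
        rw [Finset.mul_sum, ← Finset.sum_add_distrib]
        have hterm (k : κ) : Fintype.card κ * (ε k * ‖c k‖) ^ 2 + hS.eigenvalues k * ‖c k‖ ^ 2 =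
            (Fintype.card κ * ε k ^ 2 + hS.eigenvalues k) * ‖c k‖ ^ 2 := by ring
        obtain ⟨k, hk⟩ := Function.ne_iff.1 hc
        refine Finset.sum_neg' (fun k _ => ?_) ⟨k, Finset.mem_univ _, ?_⟩
        · rw [hterm]
          exact mul_nonpos_of_nonpos_of_nonneg (hε2 k).le (by positivity)
        · rw [hterm]
          exact mul_neg_of_neg_of_pos (hε2 k) (pow_pos (norm_pos_iff.2 hk) 2)
    refine le_trans ?_ hneg
    exact_mod_cast (Nat.le_of_add_le_add_right hcard : totalCount β P ≤ Fintype.card κ)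

theorem exists_isFormResolvent_unperturbedForm (hσ₀ : IsAdmissibleSigma σ₀) {c : ℝ}
    (hc : 0 < c) : ∃ B, IsFormResolvent (unperturbedForm σ₀) c B :=
  exists_isFormResolvent_productForm (laplaceOperator σ₀) (isClosed_laplaceOperator σ₀)
    (dense_laplaceDomain hσ₀) hc

theorem exists_isFormResolvent_perturbedForm (hσ₀ : IsAdmissibleSigma σ₀)
    (hβ : ∀ m, 0 < (β m).re) (hinj : Function.Injective β) (hσ : IsConjPairing β P σ) :
    ∃ c B, IsFormResolvent (perturbedForm σ₀ (expPolyKernel β P)) c B := by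
  let L : L2 →ₗ.[ℂ] Lp ℂ 2 (sigmaMeasure σ₀) :=
    ⟨perturbedFormDomain σ₀ (expPolyKernel β P), laplaceOn σ₀ (expPolyKernel β P)⟩
  have hD := perturbedFormDomain_eq (σ₀ := σ₀) hβ hinj hσ
  have hL : L = laplaceOperator σ₀ := LinearPMap.ext hD fun _ _ _ => rfl
  set V := finiteRankOperator hβ P σ
  obtain ⟨B₀, hB₀⟩ := exists_isFormResolvent_productForm L (hL ▸ isClosed_laplaceOperator σ₀)
    (hD ▸ dense_laplaceDomain hσ₀ : Dense (perturbedFormDomain σ₀ (expPolyKernel β P) : Set L2))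
    (c := ‖V‖ + 1) (by positivity)
  -- any `c > ‖V‖` makes the Neumann series converge
  refine ⟨‖V‖ + 1, exists_isFormResolvent_add V (finiteRankOperator_symm hβ hinj hσ)
    (perturbedForm_apply hβ hinj hσ) (fun f => ?_) (lt_add_one _) hB₀⟩
  rw [productForm_apply, re_inner_self]
  positivity

/-- The operator of the perturbed form is the operator sum, as the form of `V` is bounded. -/
theorem formOperator_perturbedForm (hσ₀ : IsAdmissibleSigma σ₀) (hβ : ∀ m, 0 < (β m).re)
    (hinj : Function.Injective β) (hσ : IsConjPairing β P σ) :
    formOperator (perturbedForm σ₀ (expPolyKernel β P)) =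
      formOperator (unperturbedForm σ₀) + hankelOperator (expPolyKernel β P) := by
  have hd := dense_laplaceDomain hσ₀
  have hD := perturbedFormDomain_eq (σ₀ := σ₀) hβ hinj hσ
  have hd' : Dense (perturbedFormDomain σ₀ (expPolyKernel β P) : Set L2) := hD ▸ hd
  have hsub (f g : perturbedFormDomain σ₀ (expPolyKernel β P)) (u : L2) :
      perturbedForm σ₀ (expPolyKernel β P) f g = inner ℂ (g : L2) u ↔
        unperturbedForm σ₀ (Submodule.inclusion inf_le_left f)
          (Submodule.inclusion inf_le_left g) =
          inner ℂ (g : L2) (u - finiteRankOperator hβ P σ (f : L2)) := by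
    rw [perturbedForm_apply hβ hinj hσ, inner_sub_right, eq_sub_iff_add_eq]
    rfl
  refine LinearPMap.eq_of_eq_graph (Submodule.ext fun ⟨x, u⟩ => ?_)
  rw [mem_graph_formOperator hd']
  constructor
  · rintro ⟨f, rfl, hf⟩
    obtain ⟨hx, hx'⟩ := (formOperator_apply_eq_iff hd (unperturbedForm σ₀) (f : L2)
      (u - finiteRankOperator hβ P σ (f : L2))).2
      ⟨Submodule.inclusion inf_le_left f, rfl, fun g =>
        (hsub f ⟨g, hD.ge g.2⟩ u).1 (hf ⟨g, hD.ge g.2⟩)⟩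
    refine (LinearPMap.mem_graph_iff _).2 ⟨⟨(f : L2), hx, f.2.2⟩, rfl, ?_⟩
    rw [LinearPMap.add_apply]
    refine (congrArg₂ (· + ·) hx' (hankelOperator_apply hβ hinj hσ ⟨(f : L2), f.2.2⟩)).trans ?_
    exact sub_add_cancel _ _
  · intro h
    obtain ⟨⟨x, hx, hxV⟩, rfl, hu⟩ := (LinearPMap.mem_graph_iff _).1 h
    rw [LinearPMap.add_apply] at hu
    obtain ⟨f, rfl, hf⟩ := formOperator_spec hd (unperturbedForm σ₀) ⟨x, hx⟩
    have hu' : u - finiteRankOperator hβ P σ (f : L2) =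
        formOperator (unperturbedForm σ₀) ⟨(f : L2), hx⟩ := by
      rw [← hankelOperator_apply hβ hinj hσ ⟨(f : L2), hxV⟩, sub_eq_iff_eq_add]
      exact hu.symm
    refine ⟨⟨f, hD.ge f.2⟩, rfl, fun g => (hsub _ g u).2 ?_⟩
    rw [hu']
    exact hf (Submodule.inclusion inf_le_left g)

end Perturbation

end Hankel

end

theorem mainTheorem2 (σ₀ : ℝ → ℝ) (hσ₀ : Hankel.IsAdmissibleSigma σ₀)
    (M : ℕ) (β : Fin M → ℂ) (P : Fin M → Polynomial ℂ)
    (hβ_re : ∀ m, 0 < (β m).re) (hβ_inj : Function.Injective β) (hP : ∀ m, P m ≠ 0)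
    (hv_real : ∀ t : ℝ, 0 < t →
      starRingEnd ℂ (Hankel.expPolyKernel β P t) = Hankel.expPolyKernel β P t) :
    let v : ℝ → ℂ := Hankel.expPolyKernel β P
    let V := Hankel.hankelOperator v
    let H₀ := Hankel.formOperator (Hankel.unperturbedForm σ₀)
    let H := Hankel.formOperator (Hankel.perturbedForm σ₀ v)
    IsSelfAdjoint H₀ ∧ V.domain = ⊤ ∧ IsSelfAdjoint H ∧ H = H₀ + V ∧
      Hankel.negIndex (Hankel.perturbedForm σ₀ v) = (Hankel.totalCount β P : ℕ∞) ∧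
      Hankel.negEigenvalueCount H = (Hankel.totalCount β P : ℕ∞) := by
  obtain ⟨σ, hσ⟩ := Hankel.exists_isConjPairing hβ_inj hP hv_real
  obtain ⟨B₀, hB₀⟩ := Hankel.exists_isFormResolvent_unperturbedForm hσ₀ zero_lt_one
  obtain ⟨c, B, hB⟩ := Hankel.exists_isFormResolvent_perturbedForm hσ₀ hβ_re hβ_inj hσ
  have hindex := Hankel.negIndex_perturbedForm hσ₀ hβ_re hβ_inj hP hσ
  exact ⟨hB₀.isSelfAdjoint,
    eq_top_iff.2 fun f _ => Hankel.mem_hankelDomain hβ_re hβ_inj hσ f, hB.isSelfAdjoint,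
    Hankel.formOperator_perturbedForm hσ₀ hβ_re hβ_inj hσ, hindex,
    hB.negEigenvalueCount_eq hindex⟩
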